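/- Let $\mathbb K=\mathbb R$ or $\mathbb C$, let $A$ be a unital commutative associative locally convex $\mathbb K$-algebra (with jointly continuous multiplication), and let $\mathfrak k$ be a finite-dimensional Lie algebra over $\mathbb K$. Let $\mathfrak g=A\otimes\mathfrak k$, with the bracket $[a\otimes x,b\otimes y]=ab\otimes[x,y]$ and the projective tensor product topology; write $ax=a\otimes x$ and $\mathfrak g'=[\mathfrak g,\mathfrak g]$, and give $\mathfrak g/\mathfrak g'$ the quotient topology. For a topological Lie algebra $\mathfrak h$ let $H^2_c(\mathfrak h)$ be the space of continuous $\mathbb K$-valued $2$-cocycles modulo the coboundaries $d\ell(x,y)=-\ell([x,y])$ of continuous linear functionals $\ell$, and let $H^2_c(\mathfrak g/\mathfrak g')_{1,3}\subseteq H^2_c(\mathfrak g/\mathfrak g')$ be the subspace of the classes of those continuous alternating forms $\omega$ with $\omega(ax,y)=\omega(ay,x)$ for all $a\in A$, $x,y\in\mathfrak k$ (where $ax$ stands for its class modulo $\mathfrak g'$ and $x=\mathbf 1x$). Let $Z^p(\mathfrak k),B^p(\mathfrak k),H^p(\mathfrak k)$ be the cocycles, coboundaries and cohomology of $\mathfrak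 k$ with trivial coefficients $\mathbb K$. The Koszul map $\Gamma:\mathrm{Sym}^2(\mathfrak k)^{\mathfrak k}\to Z^3(\mathfrak k)$ on the invariant symmetric bilinear forms is $\Gamma(\kappa)(x,y,z)=\kappa([x,y],z)$, and $Z^3(\mathfrak k)_\Gamma=\mathrm{im}\,\Gamma$, $B^3(\mathfrak k)_\Gamma=B^3(\mathfrak k)\cap\mathrm{im}\,\Gamma$. Let $J_A$ be the kernel of the multiplication $A\otimes A\to A$ (projective topology on $A\otimes A$, $A$ acting on the left factor), $\Omega^1_c(A)=J_A/\overline{J_A^2}$ with the quotient topology, and $d_A(a)=[\mathbf 1\otimes a-a\otimes\mathbf 1]$. Finite-dimensional spaces carry their canonical topology, $\mathrm{Lin}$ denotes continuous linear maps, and $\mathrm{Lin}((X,X'),(Y,Y'))=\{f\in\mathrm{Lin}(X,Y): f(X')\subseteq Y'\}$. **Theorem.** There are unique linear maps $\Phi$ and $\Psi$ as in the sequence below with the following properties. For every continuous alternating form $\omega$ on $\mathfrak g/\mathfrak g'$ as above and every continuous linear map $h:A\to Z^2(\mathfrak k)$, $\Phi([\omega],[h(\cdot)])$ is the class of the continuous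 cocycle $(ax,by)\mapsto\omega(ax,by)+h(ab)(x,y)$. For every continuous $2$-cocycle $f$ on $\mathfrak g$ and all $a,b\in A$, $$\Psi([f])\bigl(a\,d_A(b)-b\,d_A(a)\bigr)=\Gamma(\tilde f_1(a,b)),\qquad \tilde f_1(a,b)(x,y)=\tfrac12\bigl(f(ax,by)+f(ay,bx)\bigr).$$ With these maps the sequence $$\{0\}\to H^2_c(\mathfrak g/\mathfrak g')_{1,3}\oplus\mathrm{Lin}(A,H^2(\mathfrak k))\xrightarrow{\ \Phi\ }H^2_c(\mathfrak g)\xrightarrow{\ \Psi\ }\mathrm{Lin}\bigl((\Omega^1_c(A),\overline{d_A(A)}),(Z^3(\mathfrak k)_\Gamma,B^3(\mathfrak k)_\Gamma)\bigr)\to\{0\}$$ is exact. -/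

import Mathlib

open scoped TensorProduct Topology
open LieModule.Cohomology

noncomputable section

namespace CurrentAlg

/-! ### The projective tensor product topology -/

section Projective

variable (K M N : Type*) [RCLike K]
  [AddCommGroup M] [Module K M] [TopologicalSpace M]
  [AddCommGroup N] [Module K N] [TopologicalSpace N]

/-- The projective tensor product topology on `M ⊗ N`: the finest locally convex vector space
topology (one that is induced by a family of seminorms, Mathlib's `PolynormableSpace`) for which
the canonical bilinear map `M × N → M ⊗ N` is continuous. -/
instance projectiveTopology : TopologicalSpace (M ⊗[K] N) :=
  sInf {t | PolynormableSpace K (M ⊗[K] N) (topology := t) ∧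
    Continuous[instTopologicalSpaceProd, t] (fun p : M × N => p.1 ⊗ₜ[K] p.2)}

instance projective_polynormable : PolynormableSpace K (M ⊗[K] N) :=
  PolynormableSpace.sInf fun _ ht => ht.1

instance projective_addGroup : IsTopologicalAddGroup (M ⊗[K] N) :=
  (PolynormableSpace.withSeminorms K (M ⊗[K] N)).topologicalAddGroup

instance projective_smul : ContinuousSMul K (M ⊗[K] N) :=
  (PolynormableSpace.withSeminorms K (M ⊗[K] N)).continuousSMul

variable {K M N}

theorem continuous_tmul : Continuous (fun p : M × N => p.1 ⊗ₜ[K] p.2) :=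
  continuous_sInf_rng.2 fun _ ht => ht.2

/-- A linear map from `M ⊗ N` to a locally convex space is continuous as soon as the
corresponding bilinear map on `M × N` is. -/
theorem continuous_of_tmul {E : Type*} [AddCommGroup E] [Module K E] [TopologicalSpace E]
    [PolynormableSpace K E] (T : M ⊗[K] N →ₗ[K] E)
    (hT : Continuous (fun p : M × N => T (p.1 ⊗ₜ[K] p.2))) : Continuous T :=
  continuous_iff_le_induced.2 <| sInf_le
    ⟨PolynormableSpace.induced (𝕜 := K) (𝕜₂ := K) T, continuous_induced_rng.2 hT⟩

end Projective

/-! ### Cohomology of Lie algebras with trivial coefficients in low degrees -/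

/-- The field `K` as a trivial module of the Lie algebra `L`. -/
abbrev Coeff (K L : Type*) := TrivialLieModule K L K

section Cohomology

variable (K L : Type*) [RCLike K] [LieRing L] [LieAlgebra K L]

instance : TopologicalSpace (Coeff K L) := inferInstanceAs (TopologicalSpace K)
instance : IsTopologicalAddGroup (Coeff K L) := inferInstanceAs (IsTopologicalAddGroup K)
instance : ContinuousSMul K (Coeff K L) := inferInstanceAs (ContinuousSMul K K)

/-- The space `C²(L)` of alternating bilinear maps `L × L → K` (Mathlib's `twoCochain`). -/
def C2 : Type _ := twoCochain K L (Coeff K L)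

instance : AddCommGroup (C2 K L) := inferInstanceAs (AddCommGroup (twoCochain K L (Coeff K L)))
instance : Module K (C2 K L) := inferInstanceAs (Module K (twoCochain K L (Coeff K L)))

/-- The space of trilinear maps `L × L × L → K`, in which Mathlib's differential `d₂₃` takes its
values. -/
def Tri : Type _ := L →ₗ[K] L →ₗ[K] L →ₗ[K] Coeff K L

instance : AddCommGroup (Tri K L) :=
  inferInstanceAs (AddCommGroup (L →ₗ[K] L →ₗ[K] L →ₗ[K] Coeff K L))
instance : Module K (Tri K L) :=
  inferInstanceAs (Module K (L →ₗ[K] L →ₗ[K] L →ₗ[K] Coeff K L))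

variable {K L}

/-- The value `f(x, y)` of a 2-cochain. -/
def C2.val (f : C2 K L) (x y : L) : K := TrivialLieModule.equiv K L K (f.1 x y)

/-- The value `ω(x, y, z)` of a trilinear map. -/
def Tri.val (ω : Tri K L) (x y z : L) : K :=
  TrivialLieModule.equiv K L K
    ((show L →ₗ[K] L →ₗ[K] L →ₗ[K] Coeff K L from ω) x y z)

@[simp] theorem C2.val_add (f g : C2 K L) (x y : L) : (f + g).val x y = f.val x y + g.val x y := rfl
@[simp] theorem C2.val_smul (c : K) (f : C2 K L) (x y : L) : (c • f).val x y = c * f.val x y := rfl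
@[simp] theorem C2.val_zero (x y : L) : (0 : C2 K L).val x y = 0 := rfl
theorem C2.val_add_left (f : C2 K L) (x x' y : L) : f.val (x + x') y = f.val x y + f.val x' y := by
  simp [C2.val]
theorem C2.val_add_right (f : C2 K L) (x y y' : L) : f.val x (y + y') = f.val x y + f.val x y' := by
  simp [C2.val]
theorem C2.val_smul_left (c : K) (f : C2 K L) (x y : L) : f.val (c • x) y = c * f.val x y := by
  simp [C2.val]
theorem C2.val_smul_right (c : K) (f : C2 K L) (x y : L) : f.val x (c • y) = c * f.val x y := by
  simp [C2.val]
@[simp] theorem Tri.val_add (f g : Tri K L) (x y z : L) :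
    (f + g).val x y z = f.val x y z + g.val x y z := rfl
@[simp] theorem Tri.val_smul (c : K) (f : Tri K L) (x y z : L) :
    (c • f).val x y z = c * f.val x y z := rfl
@[simp] theorem Tri.val_zero (x y z : L) : (0 : Tri K L).val x y z = 0 := rfl

variable (K L)

/-- The differential `C¹(L) → C²(L)`, `(dℓ)(x, y) = -ℓ([x, y])`. -/
def d1 : (L →ₗ[K] Coeff K L) →ₗ[K] C2 K L := d₁₂ K L (Coeff K L)

/-- The differential on `C²(L)`, `(df)(x, y, z) = -f([x, y], z) + f([x, z], y) - f([y, z], x)`. -/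
def d2 : C2 K L →ₗ[K] Tri K L := d₂₃ K L (Coeff K L)

/-- The space `Z²(L)` of 2-cocycles. -/
def Z2 : Submodule K (C2 K L) := LinearMap.ker (d2 K L)

/-- The space `B²(L)` of 2-coboundaries. -/
def B2 : Submodule K (C2 K L) := LinearMap.range (d1 K L)

/-- The second cohomology space `H²(L) = Z²(L) / B²(L)`. -/
abbrev H2 : Type _ := Z2 K L ⧸ (B2 K L).submoduleOf (Z2 K L)

/-- The canonical topology on the finite-dimensional space of 2-cochains of a finite-dimensional
Lie algebra; `Z2 K L` carries the subspace topology and `H2 K L` the quotient topology, which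
again are the canonical ones. -/
instance [FiniteDimensional K L] : TopologicalSpace (C2 K L) := moduleTopology K _
instance [FiniteDimensional K L] : IsModuleTopology K (C2 K L) := ⟨rfl⟩
instance [FiniteDimensional K L] : IsTopologicalAddGroup (C2 K L) :=
  IsModuleTopology.topologicalAddGroup K _

section Continuous

variable [TopologicalSpace L]

/-- The space `Z²_c(L)` of continuous 2-cocycles. -/
def Z2c : Submodule K (C2 K L) where
  carrier := {f | f ∈ Z2 K L ∧ Continuous fun p : L × L => f.val p.1 p.2}
  add_mem' hf hg := ⟨add_mem hf.1 hg.1, hf.2.add hg.2⟩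
  zero_mem' := ⟨zero_mem _, continuous_const⟩
  smul_mem' c _ hf := ⟨Submodule.smul_mem _ c hf.1, hf.2.const_smul c⟩

/-- The space `B²_c(L)` of the coboundaries `dℓ` of continuous linear functionals `ℓ`. -/
def B2c : Submodule K (C2 K L) :=
  LinearMap.range (d1 K L ∘ₗ
    (ContinuousLinearMap.coeLM K : (L →L[K] Coeff K L) →ₗ[K] (L →ₗ[K] Coeff K L)))

/-- The second continuous cohomology space `H²_c(L) = Z²_c(L) / B²_c(L)`. -/
abbrev H2c : Type _ := Z2c K L ⧸ (B2c K L).submoduleOf (Z2c K L)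

end Continuous

/-! ### 3-cochains and the Koszul map -/

/-- The canonical topology on the finite-dimensional space of trilinear maps; its subspaces carry
the subspace topology. -/
instance [FiniteDimensional K L] : TopologicalSpace (Tri K L) := moduleTopology K _
instance [FiniteDimensional K L] : IsModuleTopology K (Tri K L) := ⟨rfl⟩
instance [FiniteDimensional K L] : IsTopologicalAddGroup (Tri K L) :=
  IsModuleTopology.topologicalAddGroup K _

/-- The space `Z³(L)` of 3-cocycles: alternating trilinear maps `ω` with `dω = 0`, where
`dω(x₀, …, x₃) = ∑_{i < j} (-1)^(i+j) ω([xᵢ, xⱼ], …)`. -/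
def Z3 : Submodule K (Tri K L) where
  carrier := {ω | (∀ x y, ω.val x x y = 0) ∧ (∀ x y, ω.val x y y = 0) ∧
    ∀ x₀ x₁ x₂ x₃, -ω.val ⁅x₀, x₁⁆ x₂ x₃ + ω.val ⁅x₀, x₂⁆ x₁ x₃ - ω.val ⁅x₀, x₃⁆ x₁ x₂
      - ω.val ⁅x₁, x₂⁆ x₀ x₃ + ω.val ⁅x₁, x₃⁆ x₀ x₂ - ω.val ⁅x₂, x₃⁆ x₀ x₁ = 0}
  add_mem' {f g} hf hg := by
    refine ⟨fun x y => by simp [hf.1, hg.1], fun x y => by simp [hf.2.1, hg.2.1],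
      fun x₀ x₁ x₂ x₃ => ?_⟩
    simp only [Tri.val_add]
    linear_combination hf.2.2 x₀ x₁ x₂ x₃ + hg.2.2 x₀ x₁ x₂ x₃
  zero_mem' := by simp
  smul_mem' c f hf := by
    refine ⟨fun x y => by simp [hf.1], fun x y => by simp [hf.2.1], fun x₀ x₁ x₂ x₃ => ?_⟩
    simp only [Tri.val_smul]
    linear_combination c * hf.2.2 x₀ x₁ x₂ x₃

/-- The space `B³(L)` of 3-coboundaries. -/
def B3 : Submodule K (Tri K L) := LinearMap.range (d2 K L)

/-- The space `Sym²(L)^L` of invariant symmetric bilinear forms. -/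
def SymInv : Submodule K (LinearMap.BilinForm K L) where
  carrier := {κ | (∀ x y, κ x y = κ y x) ∧ κ.lieInvariant L}
  add_mem' {f g} hf hg := by
    refine ⟨fun x y => by simp [hf.1 x y, hg.1 x y], fun x y z => ?_⟩
    simp only [LinearMap.add_apply, hf.2 x y z, hg.2 x y z]
    ring
  zero_mem' := ⟨by simp, fun x y z => by simp⟩
  smul_mem' c f hf := by
    refine ⟨fun x y => by simp [hf.1 x y], fun x y z => ?_⟩
    simp only [LinearMap.smul_apply, hf.2 x y z, smul_neg]

variable {K L} in
/-- The trilinear map `(x, y, z) ↦ κ([x, y], z)` given by a bilinear form `κ`. -/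
def koszulTri (κ : LinearMap.BilinForm K L) : Tri K L :=
  LinearMap.mk₂ K
    (fun x y => (TrivialLieModule.equiv K L K).symm.toLinearMap ∘ₗ κ ⁅x, y⁆)
    (fun x x' y => by rw [add_lie, map_add, LinearMap.comp_add])
    (fun c x y => by rw [smul_lie, map_smul, LinearMap.comp_smul])
    (fun x y y' => by rw [lie_add, map_add, LinearMap.comp_add])
    (fun c x y => by rw [lie_smul, map_smul, LinearMap.comp_smul])

variable {K L} in
@[simp] theorem koszulTri_val (κ : LinearMap.BilinForm K L) (x y z : L) :
    (koszulTri κ).val x y z = κ ⁅x, y⁆ z := rfl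

variable {K L} in
theorem koszulTri_mem (κ : SymInv K L) : koszulTri (κ : LinearMap.BilinForm K L) ∈ Z3 K L := by
  obtain ⟨κ, hs, hi⟩ := κ
  have hi' : ∀ x y z : L, κ ⁅x, y⁆ z = -κ y ⁅x, z⁆ := hi
  have h1 : ∀ x y : L, κ ⁅x, y⁆ y = 0 := fun x y => by
    have h := hi' x y y
    rw [hs y ⁅x, y⁆] at h
    exact self_eq_neg.1 h
  have hk : ∀ x y z w : L, κ ⁅⁅x, y⁆, z⁆ w = κ ⁅x, y⁆ ⁅z, w⁆ := fun x y z w => by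
    rw [← lie_skew, map_neg, LinearMap.neg_apply, hi', neg_neg]
  refine ⟨fun x y => by simp, fun x y => h1 x y, fun x₀ x₁ x₂ x₃ => ?_⟩
  simp only [koszulTri_val, hk]
  have e1 := hk x₀ x₁ x₂ x₃
  rw [lie_lie, map_sub, LinearMap.sub_apply, hi' x₀ ⁅x₁, x₂⁆ x₃, hi' x₁ ⁅x₀, x₂⁆ x₃] at e1
  have s1 := hs ⁅x₂, x₃⁆ ⁅x₀, x₁⁆
  have s2 := hs ⁅x₁, x₃⁆ ⁅x₀, x₂⁆
  have s3 := hs ⁅x₁, x₂⁆ ⁅x₀, x₃⁆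
  linear_combination 2 * e1 - s1 + s2 + s3

/-- The Koszul map `Γ : Sym²(L)^L → Z³(L)`, `Γ(κ)(x, y, z) = κ([x, y], z)`. -/
def koszul : SymInv K L →ₗ[K] Z3 K L where
  toFun κ := ⟨koszulTri κ.1, koszulTri_mem κ⟩
  map_add' _ _ := rfl
  map_smul' _ _ := rfl

/-- The space `Z³(L)_Γ = im Γ`. -/
def Z3Γ : Submodule K (Z3 K L) := LinearMap.range (koszul K L)

/-- The space `B³(L)_Γ = B³(L) ∩ im Γ`, as a subspace of `Z³(L)_Γ`. -/
def B3Γ : Submodule K (Z3Γ K L) := ((B3 K L).submoduleOf (Z3 K L)).submoduleOf (Z3Γ K L)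

/-- The commutator algebra `L' = [L, L]`. -/
abbrev comm : LieIdeal K L := ⁅(⊤ : LieIdeal K L), (⊤ : LieIdeal K L)⁆

end Cohomology

/-- The quotient topology on the quotient of a topological Lie algebra by an ideal. -/
instance quotientTopology {K L : Type*} [CommRing K] [LieRing L] [LieAlgebra K L]
    [TopologicalSpace L] (I : LieIdeal K L) : TopologicalSpace (L ⧸ I) :=
  inferInstanceAs (TopologicalSpace (L ⧸ I.toSubmodule))

/-! ### Continuous Kähler differentials -/

section Kaehler

variable (K A : Type*) [RCLike K] [CommRing A] [Algebra K A] [TopologicalSpace A]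
  [IsTopologicalRing A]

instance : ContinuousConstSMul A (A ⊗[K] A) where
  continuous_const_smul a :=
    continuous_of_tmul (LinearMap.lsmul A (A ⊗[K] A) a |>.restrictScalars K) <| by
      have : Continuous (fun p : A × A => (a * p.1, p.2)) := by fun_prop
      exact (continuous_tmul (K := K)).comp this

/-- The kernel `J_A` of the multiplication map `A ⊗ A → A`, with the subspace topology and the
`A`-module structure `a • (b ⊗ c) = ab ⊗ c`. -/
abbrev J : Submodule A (A ⊗[K] A) := (KaehlerDifferential.ideal K A).restrictScalars A

/-- The closure of `J_A²` in `J_A`. -/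
def closureJsq : Submodule A (J K A) :=
  (((KaehlerDifferential.ideal K A ^ 2).restrictScalars A).topologicalClosure).submoduleOf (J K A)

/-- The module `Ω¹_c(A) = J_A / closure (J_A²)` of continuous Kähler differentials, with the
quotient topology. -/
abbrev OmegaC : Type _ := J K A ⧸ closureJsq K A

variable {A} in
/-- The universal continuous derivation `d_A : A → Ω¹_c(A)`, `d_A(a) = [1 ⊗ a - a ⊗ 1]`. -/
def dA (a : A) : OmegaC K A :=
  Submodule.Quotient.mk ⟨1 ⊗ₜ[K] a - a ⊗ₜ[K] 1,
    KaehlerDifferential.one_smul_sub_smul_one_mem_ideal K a⟩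

end Kaehler

/-- For `X' ⊆ X` and `Y' ⊆ Y`, the space `Lin((X, X'), (Y, Y'))` of continuous linear maps
`f : X → Y` with `f(X') ⊆ Y'`. -/
def linPair {K X Y : Type*} [RCLike K] [AddCommGroup X] [Module K X] [TopologicalSpace X]
    [AddCommGroup Y] [Module K Y] [TopologicalSpace Y] [IsTopologicalAddGroup Y]
    [ContinuousSMul K Y] (X' : Set X) (Y' : Submodule K Y) : Submodule K (X →L[K] Y) where
  carrier := {f | ∀ x ∈ X', f x ∈ Y'}
  add_mem' hf hg x hx := add_mem (hf x hx) (hg x hx)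
  zero_mem' _ _ := zero_mem _
  smul_mem' c _ hf x hx := Submodule.smul_mem _ c (hf x hx)

/-! ### The maps of the exact sequence -/

section Sequence

variable (K A k : Type*) [RCLike K] [CommRing A] [Algebra K A] [TopologicalSpace A]
  [LieRing k] [LieAlgebra K k] [TopologicalSpace k]

/-- The current algebra `𝔤 = A ⊗ k` with bracket `[a ⊗ x, b ⊗ y] = ab ⊗ [x, y]` and the
projective tensor product topology. -/
abbrev Cur := A ⊗[K] k

/-- The abelian topological Lie algebra `𝔤 / 𝔤'`. -/
abbrev CurAb := Cur K A k ⧸ comm K (Cur K A k)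

variable {K A k} in
/-- The class of `a ⊗ x` in `𝔤 / 𝔤'`. -/
def cls (a : A) (x : k) : CurAb K A k :=
  LieSubmodule.Quotient.mk (N := comm K (Cur K A k)) (a ⊗ₜ[K] x)

/-- The continuous 2-cocycles on `𝔤 / 𝔤'` that vanish on
`(A ∨ 1) ⊗ (k/k' ∧ k/k')`, the subspace of `Λ²(𝔤 / 𝔤')` spanned by the elements
`ax ∧ y - ay ∧ x`. -/
def Z2c13 : Submodule K (Z2c K (CurAb K A k)) where
  carrier := {ω | ∀ (a : A) (x y : k),
    ω.1.val (cls a x) (cls 1 y) - ω.1.val (cls a y) (cls 1 x) = 0}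
  add_mem' {f g} hf hg a x y := by
    simp only [Submodule.coe_add, C2.val_add]
    linear_combination hf a x y + hg a x y
  zero_mem' a x y := by simp
  smul_mem' c f hf a x y := by
    simp only [Submodule.coe_smul, C2.val_smul]
    linear_combination c * hf a x y

/-- The space `H²_c(𝔤 / 𝔤')_{1,3}` of their cohomology classes. -/
def H2c13 : Submodule K (H2c K (CurAb K A k)) := (Z2c13 K A k).map (Submodule.mkQ _)

variable {K A k}

/-- The class in `H²_c(𝔤 / 𝔤')_{1,3}` of a cocycle in `Z2c13`. -/
def cls13 (ω : Z2c13 K A k) : H2c13 K A k :=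
  ⟨Submodule.Quotient.mk ω.1, Submodule.mem_map_of_mem ω.2⟩

/-- The symmetric bilinear form `f₁(a, b)` on `k` given by the component in
`Λ²(A) ⊗ S²(k)` of a 2-cochain `f` on `𝔤`:
`f₁(a, b)(x, y) = (f(ax, by) + f(ay, bx)) / 2`. -/
def comp1 (f : C2 K (Cur K A k)) (a b : A) : LinearMap.BilinForm K k :=
  LinearMap.mk₂ K
    (fun x y => (f.val (a ⊗ₜ[K] x) (b ⊗ₜ[K] y) + f.val (a ⊗ₜ[K] y) (b ⊗ₜ[K] x)) / 2)
    (fun x x' y => by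
      simp only [TensorProduct.tmul_add, C2.val_add_left, C2.val_add_right]; ring)
    (fun c x y => by
      simp only [TensorProduct.tmul_smul, C2.val_smul_left, C2.val_smul_right, smul_eq_mul]; ring)
    (fun x y y' => by
      simp only [TensorProduct.tmul_add, C2.val_add_left, C2.val_add_right]; ring)
    (fun c x y => by
      simp only [TensorProduct.tmul_smul, C2.val_smul_left, C2.val_smul_right, smul_eq_mul]; ring)

variable [FiniteDimensional K k]

/-- The defining property of `Φ : H²_c(𝔤/𝔤')_{1,3} ⊕ Lin(A, H²(k)) → H²_c(𝔤)`: it is the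
pull-back along `𝔤 → 𝔤/𝔤'` on the first summand, and on the second it sends the map
`a ↦ [h(a)]` given by a continuous linear map `h : A → Z²(k)` to the class of the cocycle
`(ax, by) ↦ h(ab)(x, y)`. -/
def IsPhi (Φ : (H2c13 K A k × (A →L[K] H2 K k)) →ₗ[K] H2c K (Cur K A k)) : Prop :=
  ∀ (ω : Z2c13 K A k) (h : A →L[K] Z2 K k), ∃ f : Z2c K (Cur K A k),
    (∀ (a b : A) (x y : k), f.1.val (a ⊗ₜ[K] x) (b ⊗ₜ[K] y) =
      ω.1.1.val (cls a x) (cls b y) + (h (a * b)).1.val x y) ∧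
    Φ (cls13 ω, (Submodule.mkQL ((B2 K k).submoduleOf (Z2 K k))).comp h) =
      Submodule.Quotient.mk f

variable [IsTopologicalRing A]

variable (K A k) in
/-- The space `Lin((Ω¹_c(A), closure (d_A(A))), (Z³(k)_Γ, B³(k)_Γ))`. -/
abbrev LinOmega : Submodule K (OmegaC K A →L[K] Z3Γ K k) :=
  linPair (closure (Set.range (dA K (A := A)))) (B3Γ K k)

/-- The defining property of `Ψ`: `Ψ([f])(a d_A(b) - b d_A(a)) = Γ(f₁(a, b))`. -/
def IsPsi (Ψ : H2c K (Cur K A k) →ₗ[K] LinOmega K A k) : Prop :=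
  ∀ (f : Z2c K (Cur K A k)) (a b : A),
    ((Ψ (Submodule.Quotient.mk f)).1 (a • dA K b - b • dA K a) : Tri K k) =
      koszulTri (comp1 f.1 a b)

end Sequence

end CurrentAlg

end

/-!
Write a cocycle `f` on `𝔤 = A ⊗ k` as `f(ax, by) = f₁(a, b)(x, y) + f₂(a, b)(x, y)`, where `f₁` is
skew in `a, b` and symmetric in `x, y`, and `f₂` is symmetric in `a, b` and skew in `x, y`.
Splitting the cocycle identity for `(a, b, 1)` into its skew and symmetric parts in `a, b` shows
that every `f₁(a, b)` is invariant (`comp1_mem_symInv`), that `Γ(f₁(a, 1)) = d f₂(a, 1)`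
(`koszulTri_comp1_one`) and that `f₂(a, b) = f₂(ab, 1)` on `k' × k` (`comp2_lie`). The general
identity then says that the cyclic sum of `Γ(f₁(ab, c))` is `Γ(f₁(abc, 1))`
(`koszulTri_comp1_cyclic`).

For a bilinear alternating `D`, the relation `∑ D(ab, c) = D(abc, 1)` is precisely what makes
`a d(b) ↦ (D(a, b) + D(1, ab)) / 2` a well-defined linear map on `J / J²`, and continuity carries
it to `Ω¹_c(A)` (`exists_OmegaC_hom_skew`). With `D = Γ ∘ f₁` this is `Ψ([f])`; it maps `d(a)` to
`-Γ(f₁(a, 1)) = -d f₂(a, 1)`, a coboundary. The elements `a d(b) - b d(a)` span `Ω¹_c(A)`, because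
`2a d(b) = (a d(b) - b d(a)) + d(ab)`, and so `Ψ` is unique (`OmegaC_hom_ext_skew`).

* `Φ` is injective: if `ω(ax, by) + h(ab)(x, y) = -ℓ(ab[x, y])`, taking `b = 1` and using
  `ω(ax, y) = ω(ay, x)` gives `h(a)(x, y) = -ℓ(a[x, y])`, so `[h] = 0` and then `ω = 0`.
* `ker Ψ = im Φ`: if `Γ ∘ f₁ = 0`, then `h(a) = f₂(a, 1)` is a cocycle and
  `f(ax, by) - h(ab)(x, y)` vanishes on `𝔤' × 𝔤`, hence comes from `𝔤 / 𝔤'` (`exists_eq_phi`).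
* `Ψ` is surjective: linear sections of `Γ` and of `d : C²(k) → B³(k)` produce `f₁` and `f₂` from a
  given map on `Ω¹_c(A)` (`exists_cocycle_of_skew`).

All questions of continuity reduce to finite-dimensional target spaces, where linear maps are
continuous and continuity is tested by functionals (`continuous_of_separating`), and to the fact
that `A ⊗ k` is topologically a finite power of `A` (`continuous_val_of_tmul`).
-/

noncomputable section

namespace CurrentAlg

/-! ### Finite-dimensional topological vector spaces -/

section FiniteDim

variable {K F : Type*} [RCLike K] [AddCommGroup F] [Module K F] [TopologicalSpace F]
  [IsTopologicalAddGroup F] [ContinuousSMul K F] [FiniteDimensional K F]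

theorem t2Space_of_isModuleTopology (K : Type*) {F : Type*} [RCLike K] [AddCommGroup F]
    [Module K F] [TopologicalSpace F] [FiniteDimensional K F] [IsModuleTopology K F] :
    T2Space F :=
  .of_injective_continuous (Module.finBasis K F).equivFun.injective
    (IsModuleTopology.continuous_of_linearMap (Module.finBasis K F).equivFun.toLinearMap)

variable [T2Space F]

theorem polynormableSpace_of_finiteDimensional : PolynormableSpace K F :=
  (LinearMap.isClosedEmbedding_of_injective
    (f := (Module.finBasis K F).equivFun.toLinearMap)
    (LinearMap.ker_eq_bot.2 (Module.finBasis K F).equivFun.injective)).isInducing.polynormableSpace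
      (𝕜 := K) (𝕜₂ := K)

/-- Continuity of a map into a finite-dimensional space can be tested on any family of linear
functionals that separates points. -/
theorem continuous_of_separating {X ι : Type*} [TopologicalSpace X] (φ : ι → F →ₗ[K] K)
    (hφ : ∀ v, (∀ i, φ i v = 0) → v = 0) {g : X → F} (hg : ∀ i, Continuous fun x => φ i (g x)) :
    Continuous g :=
  (LinearMap.isClosedEmbedding_of_injective (f := LinearMap.pi φ)
    (LinearMap.ker_eq_bot'.2 fun v hv => hφ v fun i => congrFun hv i)).isInducing.continuous_iff.2
      (continuous_pi hg)

end FiniteDim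

/-! ### Cochains with trivial coefficients -/

section Cochains

variable {K L : Type*} [RCLike K] [LieRing L] [LieAlgebra K L]

@[ext] theorem C2.ext {f g : C2 K L} (h : ∀ x y, f.val x y = g.val x y) : f = g :=
  Subtype.ext (LinearMap.ext₂ h)

@[ext] theorem Tri.ext {f g : Tri K L} (h : ∀ x y z, f.val x y z = g.val x y z) : f = g :=
  LinearMap.ext fun x => LinearMap.ext₂ (h x)

theorem C2.val_self (f : C2 K L) (x : L) : f.val x x = 0 := f.2 x

theorem C2.val_skew (f : C2 K L) (x y : L) : f.val x y = -f.val y x := by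
  have h := f.val_self (x + y)
  rw [C2.val_add_left, C2.val_add_right, C2.val_add_right, f.val_self, f.val_self] at h
  linear_combination h

@[simp] theorem C2.val_sub (f g : C2 K L) (x y : L) : (f - g).val x y = f.val x y - g.val x y := rfl

@[simp] theorem C2.val_zero_left (f : C2 K L) (y : L) : f.val 0 y = 0 := by
  simpa using f.val_smul_left 0 0 y

@[simp] theorem C2.val_zero_right (f : C2 K L) (x : L) : f.val x 0 = 0 := by
  simpa using f.val_smul_right 0 x 0

@[simp] theorem d1_val (ℓ : L →ₗ[K] Coeff K L) (x y : L) :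
    (d1 K L ℓ).val x y = -TrivialLieModule.equiv K L K (ℓ ⁅x, y⁆) := by
  rw [← map_neg]
  exact congrArg _ (d₁₂_apply_apply_ofTrivial K L (Coeff K L) ℓ x y)

@[simp] theorem d2_val (f : C2 K L) (x y z : L) :
    (d2 K L f).val x y z = -(f.val ⁅x, y⁆ z + f.val ⁅y, z⁆ x + f.val ⁅z, x⁆ y) := by
  have h : (d2 K L f).val x y z = -f.val ⁅x, y⁆ z + f.val ⁅x, z⁆ y - f.val ⁅y, z⁆ x := by
    have := d₂₃_apply K L (Coeff K L) f x y z
    simp only [trivial_lie_zero, sub_self, add_zero, zero_sub] at this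
    exact congrArg (TrivialLieModule.equiv K L K) this
  have h' : f.val ⁅x, z⁆ y = -f.val ⁅z, x⁆ y := by
    rw [← lie_skew, ← neg_one_smul K, C2.val_smul_left, neg_one_mul]
  rw [h, h']
  ring

theorem mem_Z2_iff {f : C2 K L} :
    f ∈ Z2 K L ↔ ∀ x y z, f.val ⁅x, y⁆ z + f.val ⁅y, z⁆ x + f.val ⁅z, x⁆ y = 0 := by
  rw [Z2, LinearMap.mem_ker, Tri.ext_iff]
  simp only [d2_val, Tri.val_zero, neg_eq_zero]

/-- A 2-cochain as a bilinear form. -/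
def C2.toBilin : C2 K L →ₗ[K] LinearMap.BilinForm K L where
  toFun f := LinearMap.mk₂ K f.val f.val_add_left f.val_smul_left f.val_add_right f.val_smul_right
  map_add' _ _ := rfl
  map_smul' _ _ := rfl

@[simp] theorem C2.toBilin_apply (f : C2 K L) (x y : L) : C2.toBilin f x y = f.val x y := rfl

/-- The 2-cochain given by an alternating bilinear form. -/
def C2.ofBilin (B : LinearMap.BilinForm K L) (hB : ∀ x, B x x = 0) : C2 K L :=
  ⟨B.compr₂ (TrivialLieModule.equiv K L K).symm.toLinearMap, hB⟩

/-- Evaluation of 2-cochains at a pair of vectors. -/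
def C2.evalL (p : L × L) : C2 K L →ₗ[K] K where
  toFun f := f.val p.1 p.2
  map_add' _ _ := rfl
  map_smul' _ _ := rfl

/-- Evaluation of trilinear maps at a triple of vectors. -/
def Tri.evalL (p : L × L × L) : Tri K L →ₗ[K] K where
  toFun f := f.val p.1 p.2.1 p.2.2
  map_add' _ _ := rfl
  map_smul' _ _ := rfl

section FiniteDim

variable [FiniteDimensional K L]

instance : FiniteDimensional K (Coeff K L) := inferInstanceAs (FiniteDimensional K K)

instance : FiniteDimensional K (C2 K L) :=
  inferInstanceAs (FiniteDimensional K (twoCochain K L (Coeff K L)))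

instance : FiniteDimensional K (Tri K L) :=
  inferInstanceAs (FiniteDimensional K (L →ₗ[K] L →ₗ[K] L →ₗ[K] Coeff K L))

instance : T2Space (C2 K L) := t2Space_of_isModuleTopology K

instance : T2Space (Tri K L) := t2Space_of_isModuleTopology K

theorem continuous_C2 {X : Type*} [TopologicalSpace X] {g : X → C2 K L}
    (hg : ∀ x y, Continuous fun t => (g t).val x y) : Continuous g :=
  continuous_of_separating (K := K) C2.evalL (fun _ hv => C2.ext fun x y => hv (x, y))
    fun p => hg p.1 p.2

theorem continuous_Tri {X : Type*} [TopologicalSpace X] {g : X → Tri K L}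
    (hg : ∀ x y z, Continuous fun t => (g t).val x y z) : Continuous g :=
  continuous_of_separating (K := K) Tri.evalL (fun _ hv => Tri.ext fun x y z => hv (x, y, z))
    fun p => hg p.1 p.2.1 p.2.2

theorem continuous_C2_val (x y : L) : Continuous fun f : C2 K L => f.val x y :=
  LinearMap.continuous_of_finiteDimensional (show C2 K L →ₗ[K] K from C2.evalL (x, y))

end FiniteDim

end Cochains

/-! ### Cochains on the current algebra -/

section Current

variable {K A k : Type*} [RCLike K] [CommRing A] [Algebra K A] [LieRing k] [LieAlgebra K k]

theorem C2.ext_tmul {f g : C2 K (A ⊗[K] k)}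
    (h : ∀ a b x y, f.val (a ⊗ₜ x) (b ⊗ₜ y) = g.val (a ⊗ₜ x) (b ⊗ₜ y)) : f = g := by
  have : C2.toBilin f = C2.toBilin g := by
    ext a x b y
    exact h a b x y
  exact C2.ext fun x y => LinearMap.congr_fun₂ this x y

theorem mem_Z2_tmul_iff {f : C2 K (A ⊗[K] k)} :
    f ∈ Z2 K (A ⊗[K] k) ↔ ∀ (a b c : A) (x y z : k),
      f.val ((a * b) ⊗ₜ ⁅x, y⁆) (c ⊗ₜ z) + f.val ((b * c) ⊗ₜ ⁅y, z⁆) (a ⊗ₜ x)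
        + f.val ((c * a) ⊗ₜ ⁅z, x⁆) (b ⊗ₜ y) = 0 := by
  rw [mem_Z2_iff]
  refine ⟨fun h a b c x y z => by
    simpa only [LieAlgebra.ExtendScalars.bracket_tmul] using h (a ⊗ₜ x) (b ⊗ₜ y) (c ⊗ₜ z),
    fun h u v w => ?_⟩
  induction u with
  | zero => simp
  | add u u' hu hu' =>
    simp only [add_lie, lie_add, C2.val_add_left, C2.val_add_right]
    linear_combination hu + hu'
  | tmul a x =>
    induction v with
    | zero => simp
    | add u u' hu hu' =>
      simp only [add_lie, lie_add, C2.val_add_left, C2.val_add_right]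
      linear_combination hu + hu'
    | tmul b y =>
      induction w with
      | zero => simp
      | add u u' hu hu' =>
        simp only [add_lie, lie_add, C2.val_add_left, C2.val_add_right]
        linear_combination hu + hu'
      | tmul c z => simpa only [LieAlgebra.ExtendScalars.bracket_tmul] using h a b c x y z

/-- The bilinear form `(ax, by) ↦ B(a, b)(x, y)` on `A ⊗ k`. -/
def curBilin (B : A →ₗ[K] A →ₗ[K] LinearMap.BilinForm K k) : LinearMap.BilinForm K (A ⊗[K] k) :=
  TensorProduct.curry <|
    TensorProduct.lift (TensorProduct.uncurry (RingHom.id K) k k K ∘ₗ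
      TensorProduct.lift B) ∘ₗ (TensorProduct.tensorTensorTensorComm K A k A k).toLinearMap

theorem curBilin_self {B : A →ₗ[K] A →ₗ[K] LinearMap.BilinForm K k}
    (hB : ∀ a b x y, B a b x y = -B b a y x) (t : A ⊗[K] k) : curBilin B t t = 0 := by
  have h : curBilin B = -(curBilin B).flip := by
    ext a x b y
    exact hB a b x y
  exact self_eq_neg.1 (LinearMap.congr_fun₂ h t t)

/-- The 2-cochain `(ax, by) ↦ B(a, b)(x, y)` on `A ⊗ k`. -/
def curCochain (B : A →ₗ[K] A →ₗ[K] LinearMap.BilinForm K k)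
    (hB : ∀ a b x y, B a b x y = -B b a y x) : C2 K (A ⊗[K] k) :=
  C2.ofBilin (curBilin B) (curBilin_self hB)

/-- The coordinate map `A ⊗ k → A`, `ax ↦ λ(x)a` of a linear functional `λ`. -/
def coordL (l : k →ₗ[K] K) : A ⊗[K] k →ₗ[K] A :=
  (TensorProduct.rid K A).toLinearMap ∘ₗ l.lTensor A

@[simp] theorem coordL_tmul (l : k →ₗ[K] K) (a : A) (x : k) :
    coordL l (a ⊗ₜ[K] x) = l x • a := by
  simp [coordL]

theorem sum_coordL [FiniteDimensional K k] (t : A ⊗[K] k) :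
    ∑ i, coordL ((Module.finBasis K k).coord i) t ⊗ₜ[K] Module.finBasis K k i = t := by
  induction t with
  | zero => simp
  | add u v hu hv => simp [TensorProduct.add_tmul, Finset.sum_add_distrib, hu, hv]
  | tmul a x =>
    simp only [coordL_tmul, TensorProduct.smul_tmul]
    rw [← TensorProduct.tmul_sum]
    exact congrArg _ ((Module.finBasis K k).sum_repr x)

theorem continuous_tmul_left [TopologicalSpace A] [TopologicalSpace k] (x : k) :
    Continuous fun a : A => a ⊗ₜ[K] x :=
  (continuous_tmul (K := K)).comp (continuous_id.prodMk continuous_const)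

section Topology

variable [TopologicalSpace A] [ContinuousSMul K A] [PolynormableSpace K A]
  [FiniteDimensional K k] [TopologicalSpace k] [IsTopologicalAddGroup k] [ContinuousSMul K k]
  [T2Space k]

theorem continuous_coordL (l : k →ₗ[K] K) : Continuous (coordL (A := A) l) := by
  refine continuous_of_tmul _ ?_
  simp only [coordL_tmul]
  have := l.continuous_of_finiteDimensional
  fun_prop

/-- Since `k` is finite-dimensional, the topology of `A ⊗ k` is that of a finite power of `A`;
hence a 2-cochain is jointly continuous as soon as it is so on the pairs `(ax, by)` with `x`, `y`
fixed. -/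
theorem continuous_val_of_tmul {f : C2 K (A ⊗[K] k)}
    (hf : ∀ x y, Continuous fun p : A × A => f.val (p.1 ⊗ₜ x) (p.2 ⊗ₜ y)) :
    Continuous fun p : (A ⊗[K] k) × (A ⊗[K] k) => f.val p.1 p.2 := by
  have h : ∀ p : (A ⊗[K] k) × (A ⊗[K] k), f.val p.1 p.2 = ∑ i, ∑ j,
      f.val (coordL ((Module.finBasis K k).coord i) p.1 ⊗ₜ Module.finBasis K k i)
        (coordL ((Module.finBasis K k).coord j) p.2 ⊗ₜ Module.finBasis K k j) := fun p => by
    conv_lhs => rw [← sum_coordL p.1, ← sum_coordL p.2, ← C2.toBilin_apply]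
    simp only [map_sum, LinearMap.sum_apply, C2.toBilin_apply]
    exact Finset.sum_comm
  simp only [h]
  refine continuous_finsetSum _ fun i _ => continuous_finsetSum _ fun j _ => ?_
  exact (hf _ _).comp (((continuous_coordL _).comp continuous_fst).prodMk
    ((continuous_coordL _).comp continuous_snd))

theorem continuous_of_continuous_tmul_left {ℓ : A ⊗[K] k →ₗ[K] K}
    (hℓ : ∀ x, Continuous fun a : A => ℓ (a ⊗ₜ x)) : Continuous ℓ := by
  have h : ∀ t, ℓ t = ∑ i,
      ℓ (coordL ((Module.finBasis K k).coord i) t ⊗ₜ Module.finBasis K k i) := fun t => by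
    conv_lhs => rw [← sum_coordL t, map_sum]
  rw [funext h]
  exact continuous_finsetSum _ fun i _ => (hℓ _).comp (continuous_coordL _)

end Topology

end Current

/-! ### The two components of a cocycle on the current algebra -/

section Components

variable {K A k : Type*} [RCLike K] [CommRing A] [Algebra K A] [LieRing k] [LieAlgebra K k]

/-- The alternating form `f₂(a, b)` on `k` given by the component in `S²(A) ⊗ Λ²(k)` of a 2-cochain
`f` on `A ⊗ k`: `f₂(a, b)(x, y) = (f(ax, by) - f(ay, bx)) / 2`. -/
def comp2 (f : C2 K (A ⊗[K] k)) (a b : A) : C2 K k :=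
  let B := (C2.toBilin f).compl₁₂ (TensorProduct.mk K A k a) (TensorProduct.mk K A k b)
  C2.ofBilin ((2 : K)⁻¹ • (B - B.flip)) fun x => by simp

theorem comp1_apply (f : C2 K (A ⊗[K] k)) (a b : A) (x y : k) :
    comp1 f a b x y = (f.val (a ⊗ₜ[K] x) (b ⊗ₜ[K] y) + f.val (a ⊗ₜ[K] y) (b ⊗ₜ[K] x)) / 2 := rfl

theorem comp2_val (f : C2 K (A ⊗[K] k)) (a b : A) (x y : k) :
    (comp2 f a b).val x y =
      (f.val (a ⊗ₜ[K] x) (b ⊗ₜ[K] y) - f.val (a ⊗ₜ[K] y) (b ⊗ₜ[K] x)) / 2 := by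
  rw [div_eq_inv_mul]
  rfl

theorem val_eq_comp (f : C2 K (A ⊗[K] k)) (a b : A) (x y : k) :
    f.val (a ⊗ₜ[K] x) (b ⊗ₜ[K] y) = comp1 f a b x y + (comp2 f a b).val x y := by
  rw [comp1_apply, comp2_val]
  ring

theorem comp1_symm (f : C2 K (A ⊗[K] k)) (a b : A) (x y : k) :
    comp1 f a b x y = comp1 f a b y x := by
  rw [comp1_apply, comp1_apply, add_comm]

theorem comp1_skew (f : C2 K (A ⊗[K] k)) (a b : A) (x y : k) :
    comp1 f a b x y = -comp1 f b a x y := by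
  rw [comp1_apply, comp1_apply, f.val_skew (b ⊗ₜ x), f.val_skew (b ⊗ₜ y)]
  ring

theorem comp2_comm (f : C2 K (A ⊗[K] k)) (a b : A) : comp2 f a b = comp2 f b a := by
  ext x y
  rw [comp2_val, comp2_val, f.val_skew (b ⊗ₜ x), f.val_skew (b ⊗ₜ y)]
  ring

variable {f : C2 K (A ⊗[K] k)}

/-- The cocycle identity on pure tensors, split into components. -/
theorem cocycle_comp (hf : f ∈ Z2 K (A ⊗[K] k)) (a b c : A) (x y z : k) :
    comp1 f (a * b) c ⁅x, y⁆ z + (comp2 f (a * b) c).val ⁅x, y⁆ z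
      + (comp1 f (b * c) a ⁅y, z⁆ x + (comp2 f (b * c) a).val ⁅y, z⁆ x)
      + (comp1 f (c * a) b ⁅z, x⁆ y + (comp2 f (c * a) b).val ⁅z, x⁆ y) = 0 := by
  simpa only [val_eq_comp] using mem_Z2_tmul_iff.1 hf a b c x y z

/-- The part of the identity for `(a, b, 1)` that is skew in `a` and `b`. -/
theorem comp1_lie_cyclic (hf : f ∈ Z2 K (A ⊗[K] k)) (a b : A) (x y z : k) :
    comp1 f a b ⁅x, y⁆ z = comp1 f a b ⁅y, z⁆ x := by
  have h1 := cocycle_comp hf a b 1 z x y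
  have h2 := cocycle_comp hf b a 1 z x y
  simp only [mul_one, one_mul, mul_comm b a, comp2_comm f b a, comp1_skew f b a] at h1 h2
  linear_combination (h2 - h1) / 2

theorem comp1_mem_symInv (hf : f ∈ Z2 K (A ⊗[K] k)) (a b : A) : comp1 f a b ∈ SymInv K k := by
  refine ⟨comp1_symm f a b, fun x y z => ?_⟩
  rw [comp1_lie_cyclic hf, comp1_lie_cyclic hf, ← lie_skew, map_neg, LinearMap.neg_apply,
    comp1_symm]

/-- The part of the identity for `(a, b, 1)` that is symmetric in `a` and `b`. -/
theorem comp_symm_part (hf : f ∈ Z2 K (A ⊗[K] k)) (a b : A) (x y z : k) :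
    comp1 f (a * b) 1 ⁅x, y⁆ z + (comp2 f (a * b) 1).val ⁅x, y⁆ z
      + (comp2 f a b).val ⁅y, z⁆ x + (comp2 f a b).val ⁅z, x⁆ y = 0 := by
  have h1 := cocycle_comp hf a b 1 x y z
  have h2 := cocycle_comp hf b a 1 x y z
  simp only [mul_one, one_mul, mul_comm b a, comp2_comm f b a, comp1_skew f b a] at h1 h2
  linear_combination (h2 + h1) / 2

theorem koszulTri_comp1_one (hf : f ∈ Z2 K (A ⊗[K] k)) (a : A) :
    koszulTri (comp1 f a 1) = d2 K k (comp2 f a 1) := by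
  ext x y z
  have h := comp_symm_part hf a 1 x y z
  rw [mul_one] at h
  rw [koszulTri_val, d2_val]
  linear_combination h

/-- On `k' × k` the form `f₂(a, b)` depends only on the product `ab`. -/
theorem comp2_lie (hf : f ∈ Z2 K (A ⊗[K] k)) (a b : A) (x y z : k) :
    (comp2 f a b).val ⁅x, y⁆ z = (comp2 f (a * b) 1).val ⁅x, y⁆ z := by
  -- The difference of the two sides, as a function of `(x, y, z)`, has the property that any two
  -- of its three cyclic translates add up to zero.
  have key : ∀ x y z : k,
      ((comp2 f (a * b) 1).val ⁅y, z⁆ x - (comp2 f a b).val ⁅y, z⁆ x)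
        + ((comp2 f (a * b) 1).val ⁅z, x⁆ y - (comp2 f a b).val ⁅z, x⁆ y) = 0 := fun x y z => by
    have h1 := comp_symm_part hf a b x y z
    have h2 := comp_symm_part hf (a * b) 1 x y z
    rw [mul_one] at h2
    linear_combination h2 - h1
  linear_combination (key x y z - key y z x - key z x y) / 2

theorem koszulTri_comp1_cyclic (hf : f ∈ Z2 K (A ⊗[K] k)) (a b c : A) :
    koszulTri (comp1 f (a * b) c) + koszulTri (comp1 f (b * c) a) + koszulTri (comp1 f (c * a) b) =
      koszulTri (comp1 f (a * b * c) 1) := by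
  ext x y z
  have h := cocycle_comp hf a b c x y z
  rw [comp2_lie hf, comp2_lie hf (b * c), comp2_lie hf (c * a), mul_comm (b * c) a,
    mul_comm (c * a) b, ← mul_assoc, mul_comm c a, ← mul_assoc, mul_comm b a] at h
  have c1 := comp1_lie_cyclic hf (b * c) a x y z
  have c2 := comp1_lie_cyclic hf (a * c) b z x y
  have h1 := comp_symm_part hf (a * b * c) 1 x y z
  rw [mul_one] at h1
  simp only [Tri.val_add, koszulTri_val]
  rw [mul_comm c a]
  linear_combination h - h1 + c1 - c2

/-- Conversely, a cochain `(ax, by) ↦ σ(a, b)(x, y) + η(ab)(x, y)` with invariant symmetric forms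
`σ(a, b)` is a cocycle if the cyclic sum of `Γ(σ(ab, c))` is `dη(abc)`. -/
theorem mem_Z2_of_comp {σ : A → A → SymInv K k} {η : A → C2 K k}
    (hf : ∀ a b x y, f.val (a ⊗ₜ x) (b ⊗ₜ y) = (σ a b).1 x y + (η (a * b)).val x y)
    (h : ∀ a b c, koszulTri (σ (a * b) c).1 + koszulTri (σ (b * c) a).1 + koszulTri (σ (c * a) b).1
      = d2 K k (η (a * b * c))) : f ∈ Z2 K (A ⊗[K] k) := by
  have cyc : ∀ (κ : SymInv K k) (x y z : k), κ.1 ⁅x, y⁆ z = κ.1 ⁅y, z⁆ x := fun κ x y z => by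
    have hi : ∀ x y z : k, κ.1 ⁅x, y⁆ z = -κ.1 y ⁅x, z⁆ := κ.2.2
    rw [← lie_skew, map_neg, LinearMap.neg_apply, hi, neg_neg, κ.2.1]
  refine mem_Z2_tmul_iff.2 fun a b c x y z => ?_
  have h' := congrArg (fun t : Tri K k => t.val x y z) (h a b c)
  simp only [Tri.val_add, koszulTri_val, d2_val] at h'
  rw [hf, hf, hf, ← cyc _ x y z, cyc _ z x y, ← mul_rotate a b c, mul_rotate c a b]
  linear_combination h'

end Components

/-! ### Continuous Kähler differentials -/

section Omega

variable {K A : Type*} [RCLike K] [CommRing A] [Algebra K A]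

theorem tmul_sub_mem_J (a b : A) : a ⊗ₜ[K] b - (a * b) ⊗ₜ[K] 1 ∈ J K A := by
  have h := Submodule.smul_mem (J K A) a (KaehlerDifferential.one_smul_sub_smul_one_mem_ideal K b)
  simpa only [smul_sub, TensorProduct.smul_tmul', smul_eq_mul, mul_one] using h

/-- The elements of `J` are the finite sums of elements `a • (1 ⊗ b - b ⊗ 1)`. -/
theorem J_induction {P : A ⊗[K] A → Prop} (h0 : P 0) (hadd : ∀ u v, P u → P v → P (u + v))
    (h : ∀ a b : A, P (a ⊗ₜ b - (a * b) ⊗ₜ 1)) {u : A ⊗[K] A}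
    (hu : u ∈ KaehlerDifferential.ideal K A) : P u := by
  have hu' : u ∈ (KaehlerDifferential.ideal K A).restrictScalars A := hu
  rw [← KaehlerDifferential.submodule_span_range_eq_ideal] at hu'
  refine Submodule.closure_induction (p := fun x _ => P x) h0 (fun x y _ _ => hadd x y) ?_ hu'
  rintro a _ ⟨b, rfl⟩
  simpa only [smul_sub, TensorProduct.smul_tmul', smul_eq_mul, mul_one] using h a b

theorem J_hom_ext {E : Type*} [AddCommGroup E] [Module K E] {φ ψ : J K A →ₗ[K] E}
    (h : ∀ a b : A, φ ⟨a ⊗ₜ[K] b - (a * b) ⊗ₜ[K] 1, tmul_sub_mem_J a b⟩ =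
      ψ ⟨a ⊗ₜ[K] b - (a * b) ⊗ₜ[K] 1, tmul_sub_mem_J a b⟩) : φ = ψ := by
  ext ⟨u, hu⟩
  have key : ∃ hu : u ∈ J K A, φ ⟨u, hu⟩ = ψ ⟨u, hu⟩ := by
    refine J_induction (P := fun u => ∃ hu : u ∈ J K A, φ ⟨u, hu⟩ = ψ ⟨u, hu⟩) ?_ ?_
      (fun a b => ⟨_, h a b⟩) hu
    · exact ⟨zero_mem _, (map_zero φ).trans (map_zero ψ).symm⟩
    · rintro u v ⟨hu, hu'⟩ ⟨hv, hv'⟩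
      refine ⟨add_mem hu hv, ?_⟩
      rw [← AddMemClass.mk_add_mk, map_add, map_add, hu', hv']
  exact key.2

variable [TopologicalSpace A] [IsTopologicalRing A]

theorem smul_dA (a b : A) :
    a • dA K b = Submodule.Quotient.mk (p := closureJsq K A)
      ⟨a ⊗ₜ[K] b - (a * b) ⊗ₜ[K] 1, tmul_sub_mem_J a b⟩ := by
  rw [dA, ← Submodule.Quotient.mk_smul]
  congr 1
  ext1
  simp only [Submodule.coe_smul, smul_sub, TensorProduct.smul_tmul', smul_eq_mul, mul_one]

theorem continuous_smul_dA : Continuous fun p : A × A => p.1 • dA K p.2 := by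
  simp only [smul_dA]
  refine continuous_quot_mk.comp (Continuous.subtype_mk ?_ _)
  have h1 : Continuous fun p : A × A => p.1 ⊗ₜ[K] p.2 := continuous_tmul
  have h2 : Continuous fun p : A × A => (p.1 * p.2) ⊗ₜ[K] (1 : A) :=
    h1.comp ((continuous_fst.mul continuous_snd).prodMk continuous_const)
  exact h1.sub h2

theorem continuous_dA : Continuous (dA K (A := A)) := by
  have h := (continuous_smul_dA (K := K) (A := A)).comp
    (continuous_const (y := (1 : A)).prodMk continuous_id)
  simpa only [Function.comp_def, id, one_smul] using h

theorem dA_add (a b : A) : dA K (a + b) = dA K a + dA K b := by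
  rw [dA, dA, dA, ← Submodule.Quotient.mk_add]
  congr 1
  ext1
  simp only [Submodule.coe_add, TensorProduct.tmul_add, TensorProduct.add_tmul]
  abel

theorem dA_smul (c : K) (a : A) : dA K (c • a) = c • dA K a := by
  rw [dA, dA, ← Submodule.Quotient.mk_smul]
  congr 1
  ext1
  change 1 ⊗ₜ[K] (c • a) - (c • a) ⊗ₜ[K] 1 = c • (1 ⊗ₜ[K] a - a ⊗ₜ[K] 1)
  rw [smul_sub, TensorProduct.tmul_smul, TensorProduct.smul_tmul', TensorProduct.smul_tmul']

variable (K A) in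
/-- The derivation `d_A` as a linear map over `K`. -/
def dAL : A →ₗ[K] OmegaC K A where
  toFun := dA K
  map_add' := dA_add
  map_smul' := dA_smul

theorem mk_eq_zero_of_mem_sq {u : J K A} (hu : (u : A ⊗[K] A) ∈ KaehlerDifferential.ideal K A ^ 2) :
    (Submodule.Quotient.mk u : OmegaC K A) = 0 :=
  (Submodule.Quotient.mk_eq_zero _).2 (subset_closure hu)

theorem dA_mul (a b : A) : dA K (a * b) = a • dA K b + b • dA K a := by
  rw [← sub_eq_zero, smul_dA, smul_dA, dA, ← Submodule.Quotient.mk_add, ← Submodule.Quotient.mk_sub]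
  refine mk_eq_zero_of_mem_sq ?_
  have h := Ideal.mul_mem_mul (KaehlerDifferential.one_smul_sub_smul_one_mem_ideal K a)
    (KaehlerDifferential.one_smul_sub_smul_one_mem_ideal K b)
  rw [← pow_two] at h
  convert h using 1
  simp only [Submodule.coe_sub, Submodule.coe_add, mul_sub, sub_mul,
    Algebra.TensorProduct.tmul_mul_tmul, one_mul, mul_one, mul_comm b a]
  abel

theorem dA_one : dA K (1 : A) = 0 := by
  have h := dA_mul (K := K) (1 : A) 1
  rwa [mul_one, one_smul, left_eq_add] at h

theorem OmegaC_hom_ext {E : Type*} [AddCommGroup E] [Module K E] {φ ψ : OmegaC K A →ₗ[K] E}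
    (h : ∀ a b : A, φ (a • dA K b) = ψ (a • dA K b)) : φ = ψ := by
  have key : φ ∘ₗ (closureJsq K A).mkQ.restrictScalars K =
      ψ ∘ₗ (closureJsq K A).mkQ.restrictScalars K := by
    refine J_hom_ext fun a b => ?_
    have := h a b
    rw [smul_dA] at this
    exact this
  refine LinearMap.ext fun ω => ?_
  obtain ⟨u, rfl⟩ := Submodule.Quotient.mk_surjective _ ω
  exact LinearMap.congr_fun key u

/-- The elements `a d(b) - b d(a)` span `Ω¹_c(A)`: since `d(1) = 0`, the case `b = 1` gives the
elements `d(a)`, and `2a d(b) = (a d(b) - b d(a)) + d(ab)`. -/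
theorem OmegaC_hom_ext_skew {E : Type*} [AddCommGroup E] [Module K E] {φ ψ : OmegaC K A →ₗ[K] E}
    (h : ∀ a b : A, φ (a • dA K b - b • dA K a) = ψ (a • dA K b - b • dA K a)) : φ = ψ := by
  refine OmegaC_hom_ext fun a b => ?_
  have e : a • dA K b = (2 : K)⁻¹ • ((a • dA K b - b • dA K a)
      + ((1 : A) • dA K (a * b) - (a * b) • dA K (1 : A))) := by
    have e' : a • dA K b - b • dA K a + (a • dA K b + b • dA K a) = (2 : K) • (a • dA K b) := by
      rw [two_smul]
      abel
    rw [dA_one, smul_zero, sub_zero, one_smul, dA_mul, e', inv_smul_smul₀ two_ne_zero]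
  rw [e, map_smul, map_smul, map_add, map_add, h, h]

/-- The alternating form `(a, b) ↦ φ(a d(b) - b d(a))` of a linear map `φ` on `Ω¹_c(A)`. -/
def skewForm {E : Type*} [AddCommGroup E] [Module K E] (φ : OmegaC K A →ₗ[K] E) :
    A →ₗ[K] A →ₗ[K] E :=
  LinearMap.mk₂ K (fun a b => φ (a • dA K b - b • dA K a))
    (fun a a' b => by rw [← map_add, dA_add, add_smul, smul_add]; congr 1; abel)
    (fun c a b => by rw [← map_smul, dA_smul, smul_assoc, smul_comm b c, smul_sub])
    (fun a b b' => by rw [← map_add, dA_add, add_smul, smul_add]; congr 1; abel)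
    (fun c a b => by rw [← map_smul, dA_smul, smul_assoc, smul_comm a c, smul_sub])

theorem skewForm_apply {E : Type*} [AddCommGroup E] [Module K E] (φ : OmegaC K A →ₗ[K] E)
    (a b : A) : skewForm φ a b = φ (a • dA K b - b • dA K a) := rfl

theorem continuous_skewForm {E : Type*} [AddCommGroup E] [Module K E] [TopologicalSpace E]
    [IsTopologicalAddGroup E] (φ : OmegaC K A →L[K] E) :
    Continuous fun p : A × A => skewForm φ.toLinearMap p.1 p.2 := by
  have h1 : Continuous fun p : A × A => φ (p.1 • dA K p.2) := φ.continuous.comp continuous_smul_dA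
  have h2 : Continuous fun p : A × A => φ (p.2 • dA K p.1) :=
    h1.comp (g := fun p : A × A => φ (p.1 • dA K p.2)) (f := Prod.swap) continuous_swap
  have h : ∀ p : A × A, skewForm φ.toLinearMap p.1 p.2 =
    φ (p.1 • dA K p.2) - φ (p.2 • dA K p.1) := fun p => map_sub φ.toLinearMap _ _
  rw [funext h]
  exact h1.sub h2

theorem skewForm_skew {E : Type*} [AddCommGroup E] [Module K E] (φ : OmegaC K A →ₗ[K] E)
    (a b : A) : skewForm φ a b = -skewForm φ b a := by
  rw [skewForm_apply, skewForm_apply, ← map_neg, neg_sub]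

theorem skewForm_cyclic {E : Type*} [AddCommGroup E] [Module K E] (φ : OmegaC K A →ₗ[K] E)
    (a b c : A) : skewForm φ (a * b) c + skewForm φ (b * c) a + skewForm φ (c * a) b =
      -φ (dA K (a * b * c)) := by
  rw [skewForm_apply, skewForm_apply, skewForm_apply, ← map_add, ← map_add, ← map_neg]
  congr 1
  simp only [dA_mul, smul_add, smul_smul, mul_comm c b, mul_comm c a, mul_comm b a]
  abel

variable {E : Type*} [AddCommGroup E] [Module K E] [TopologicalSpace E]
  [IsTopologicalAddGroup E] [ContinuousSMul K E] [FiniteDimensional K E] [T2Space E]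

/-- The universal property of `Ω¹_c(A)` for continuous bilinear maps `β` on `A × A` that satisfy
the identities of `(a, b) ↦ a d(b)`: these say that the linear extension of `β` to `A ⊗ A` is zero
on `J²`, hence by continuity on its closure. -/
theorem exists_OmegaC_hom (β : A →ₗ[K] A →ₗ[K] E) (hc : Continuous fun p : A × A => β p.1 p.2)
    (h1 : ∀ a, β a 1 = 0) (hm : ∀ a b c, β a (b * c) = β (a * b) c + β (a * c) b) :
    ∃ φ : OmegaC K A →L[K] E, ∀ a b, φ (a • dA K b) = β a b := by
  have := polynormableSpace_of_finiteDimensional (K := K) (F := E)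
  have hcont : Continuous (TensorProduct.lift β) := continuous_of_tmul _ hc
  have hsq : ∀ u ∈ KaehlerDifferential.ideal K A ^ 2, TensorProduct.lift β u = 0 := by
    intro u hu
    rw [pow_two] at hu
    refine Submodule.mul_induction_on hu (fun m hm' n hn => ?_) fun x y hx hy => by
      rw [map_add, hx, hy, add_zero]
    refine J_induction (P := fun m => TensorProduct.lift β (m * n) = 0) (by simp)
      (fun x y hx hy => by rw [add_mul, map_add, hx, hy, add_zero]) (fun a b => ?_) hm'
    refine J_induction (P := fun n => TensorProduct.lift β (_ * n) = 0) (by simp)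
      (fun x y hx hy => by rw [mul_add, map_add, hx, hy, add_zero]) (fun c d => ?_) hn
    simp only [mul_sub, sub_mul, Algebra.TensorProduct.tmul_mul_tmul, mul_one, map_sub,
      TensorProduct.lift.tmul, h1, one_mul, sub_zero]
    rw [hm (a * c), mul_right_comm a c b, mul_assoc a c d]
    abel
  have hcl : ∀ u ∈ closureJsq K A, TensorProduct.lift β (u : A ⊗[K] A) = 0 := fun u hu =>
    closure_minimal (t := {u | TensorProduct.lift β u = 0}) hsq
      (isClosed_singleton.preimage hcont) hu
  let φ₀ : OmegaC K A →ₗ[K] E :=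
    (((closureJsq K A).restrictScalars K).liftQ
      (TensorProduct.lift β ∘ₗ (J K A).subtype.restrictScalars K) hcl) ∘ₗ
      (Submodule.Quotient.restrictScalarsEquiv K (closureJsq K A)).symm.toLinearMap
  have hφ : ∀ u : J K A, φ₀ (Submodule.Quotient.mk u) = TensorProduct.lift β (u : A ⊗[K] A) :=
    fun _ => rfl
  refine ⟨⟨φ₀, (closureJsq K A).isQuotientMap_mkQ.continuous_iff.2
    (hcont.comp continuous_subtype_val)⟩, fun a b => ?_⟩
  change φ₀ _ = _
  rw [smul_dA, hφ, map_sub, TensorProduct.lift.tmul, TensorProduct.lift.tmul, h1, sub_zero]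

/-- A continuous alternating bilinear map `D` on `A` is of the form `φ(a d(b) - b d(a))` as soon as
it satisfies the cyclic identity of `(a, b) ↦ a d(b) - b d(a)`; then
`φ(a d(b)) = (D(a, b) + D(1, ab)) / 2`. -/
theorem exists_OmegaC_hom_skew (D : A →ₗ[K] A →ₗ[K] E) (hc : Continuous fun p : A × A => D p.1 p.2)
    (hs : ∀ a b, D a b = -D b a)
    (hm : ∀ a b c, D (a * b) c + D (b * c) a + D (c * a) b = D (a * b * c) 1) :
    ∃ φ : OmegaC K A →L[K] E, ∀ a b, φ (a • dA K b - b • dA K a) = D a b := by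
  have hβ : ∀ a b, ((2 : K)⁻¹ • (D + (LinearMap.mul K A).compr₂ (D 1))) a b =
    (2 : K)⁻¹ • (D a b + D 1 (a * b)) := fun _ _ => rfl
  have hD : Continuous fun p : A × A => D 1 (p.1 * p.2) :=
    hc.comp (continuous_const.prodMk (continuous_fst.mul continuous_snd))
  have h1 : ∀ a, ((2 : K)⁻¹ • (D + (LinearMap.mul K A).compr₂ (D 1))) a 1 = 0 := fun a => by
    rw [hβ, mul_one, hs 1 a, add_neg_cancel, smul_zero]
  obtain ⟨φ, hφ⟩ := exists_OmegaC_hom ((2 : K)⁻¹ • (D + (LinearMap.mul K A).compr₂ (D 1)))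
    ((hc.add hD).const_smul _) h1 fun a b c => by
      have h := hm a b c
      rw [hs (b * c) a, hs _ 1, mul_comm c a] at h
      rw [hβ, hβ, hβ, mul_right_comm a c b, ← mul_assoc a b c]
      have h' : D a (b * c) = D (a * b) c + D (a * c) b + D 1 (a * b * c) := by
        rw [← sub_eq_zero, ← neg_eq_zero, ← eq_neg_iff_add_eq_zero.1 h]
        abel
      rw [h']
      module
  refine ⟨φ, fun a b => ?_⟩
  rw [map_sub, hφ, hφ, hβ, hβ, hs b a, mul_comm b a]
  module

end Omega

/-! ### Cochains pulled back from `𝔤 / 𝔤'` and cochains factoring through the product of `A` -/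

section Abelian

variable {K A k : Type*} [RCLike K] [CommRing A] [Algebra K A] [LieRing k] [LieAlgebra K k]

variable (K A k) in
/-- The projection `𝔤 → 𝔤 / 𝔤'`. -/
def toAb : A ⊗[K] k →ₗ[K] CurAb K A k := (comm K (A ⊗[K] k)).toSubmodule.mkQ

theorem toAb_surjective : Function.Surjective (toAb K A k) := Submodule.mkQ_surjective _

theorem toAb_lie (u v : A ⊗[K] k) : toAb K A k ⁅u, v⁆ = 0 :=
  (Submodule.Quotient.mk_eq_zero _).2
    (LieSubmodule.lie_mem_lie (LieSubmodule.mem_top u) (LieSubmodule.mem_top v))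

theorem curAb_lie (u v : CurAb K A k) : ⁅u, v⁆ = 0 := by
  obtain ⟨u, rfl⟩ := toAb_surjective u
  obtain ⟨v, rfl⟩ := toAb_surjective v
  exact toAb_lie u v

theorem cls_lie (a : A) (x y : k) : cls a ⁅x, y⁆ = (0 : CurAb K A k) := by
  have h := toAb_lie (a ⊗ₜ[K] x) (1 ⊗ₜ[K] y)
  rwa [LieAlgebra.ExtendScalars.bracket_tmul, mul_one] at h

/-- The pull-back to `𝔤` of a 2-cochain on `𝔤 / 𝔤'`. -/
def pullAb (ω : C2 K (CurAb K A k)) : C2 K (A ⊗[K] k) :=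
  C2.ofBilin ((C2.toBilin ω).compl₁₂ (toAb K A k) (toAb K A k)) fun _ => ω.val_self _

@[simp] theorem pullAb_val (ω : C2 K (CurAb K A k)) (u v : A ⊗[K] k) :
    (pullAb ω).val u v = ω.val (toAb K A k u) (toAb K A k v) := rfl

theorem pullAb_mem_Z2 (ω : C2 K (CurAb K A k)) : pullAb ω ∈ Z2 K (A ⊗[K] k) :=
  mem_Z2_iff.2 fun x y z => by simp [toAb_lie]

theorem curAb_ext {ω ω' : C2 K (CurAb K A k)}
    (h : ∀ a b x y, ω.val (cls a x) (cls b y) = ω'.val (cls a x) (cls b y)) : ω = ω' := by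
  have h' : pullAb ω = pullAb ω' := C2.ext_tmul h
  ext u v
  obtain ⟨u, rfl⟩ := toAb_surjective u
  obtain ⟨v, rfl⟩ := toAb_surjective v
  exact congrArg (fun f : C2 K (A ⊗[K] k) => f.val u v) h'

theorem mem_Z2_curAb (ω : C2 K (CurAb K A k)) : ω ∈ Z2 K (CurAb K A k) :=
  mem_Z2_iff.2 fun x y z => by simp [curAb_lie]

/-- A 2-cochain on `𝔤` that vanishes on `𝔤' × 𝔤` is pulled back from `𝔤 / 𝔤'`. -/
theorem exists_pullAb_eq {g : C2 K (A ⊗[K] k)}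
    (hg : ∀ (a b c : A) (x y z : k), g.val ((a * b) ⊗ₜ ⁅x, y⁆) (c ⊗ₜ z) = 0) :
    ∃ ω, pullAb ω = g := by
  have h1 : ∀ u v w : A ⊗[K] k, g.val ⁅u, v⁆ w = 0 := by
    intro u v w
    induction u with
    | zero => simp
    | add u u' hu hu' => rw [add_lie, C2.val_add_left, hu, hu', add_zero]
    | tmul a x =>
      induction v with
      | zero => simp
      | add u u' hu hu' => rw [lie_add, C2.val_add_left, hu, hu', add_zero]
      | tmul b y =>
        induction w with
        | zero => simp
        | add u u' hu hu' => rw [C2.val_add_right, hu, hu', add_zero]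
        | tmul c z => exact hg a b c x y z
  have h2 : (comm K (A ⊗[K] k)).toSubmodule ≤ LinearMap.ker (C2.toBilin g) := by
    rw [LieSubmodule.lieIdeal_oper_eq_linear_span', Submodule.span_le]
    rintro _ ⟨u, -, v, -, rfl⟩
    exact LinearMap.ext fun w => h1 u v w
  let B₁ : CurAb K A k →ₗ[K] A ⊗[K] k →ₗ[K] K := Submodule.liftQ _ (C2.toBilin g) h2
  have hB₁ : ∀ u v, B₁ (toAb K A k u) v = g.val u v := fun _ _ => rfl
  have h3 : (comm K (A ⊗[K] k)).toSubmodule ≤ LinearMap.ker B₁.flip := fun v hv => by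
    refine LinearMap.ext fun u => ?_
    obtain ⟨u, rfl⟩ := toAb_surjective u
    change g.val u v = 0
    rw [g.val_skew, neg_eq_zero]
    exact LinearMap.congr_fun (h2 hv) u
  let B₂ : LinearMap.BilinForm K (CurAb K A k) := (Submodule.liftQ _ B₁.flip h3).flip
  have hB₂ : ∀ u v, B₂ (toAb K A k u) (toAb K A k v) = g.val u v := fun _ _ => rfl
  refine ⟨C2.ofBilin B₂ fun u => ?_, rfl⟩
  obtain ⟨u, rfl⟩ := toAb_surjective u
  rw [hB₂, g.val_self]

/-- The 2-cochain `(ax, by) ↦ η(ab)(x, y)` on `A ⊗ k`. -/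
def mulCochain (η : A →ₗ[K] C2 K k) : C2 K (A ⊗[K] k) :=
  curCochain ((LinearMap.mul K A).compr₂ (C2.toBilin ∘ₗ η)) fun a b x y => by
    simp [mul_comm b a, (η (a * b)).val_skew x y]

@[simp] theorem mulCochain_tmul (η : A →ₗ[K] C2 K k) (a b : A) (x y : k) :
    (mulCochain η).val (a ⊗ₜ x) (b ⊗ₜ y) = (η (a * b)).val x y := rfl

theorem mulCochain_mem_Z2 {η : A →ₗ[K] C2 K k} (hη : ∀ a, η a ∈ Z2 K k) :
    mulCochain η ∈ Z2 K (A ⊗[K] k) := by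
  refine mem_Z2_of_comp (σ := fun _ _ => 0) (η := η) (fun a b x y => by simp) fun a b c => ?_
  rw [LinearMap.mem_ker.1 (hη _)]
  ext x y z
  simp

section Topology

variable [TopologicalSpace A] [TopologicalSpace k]

theorem isOpenQuotientMap_toAb : IsOpenQuotientMap (toAb K A k) :=
  Submodule.isOpenQuotientMap_mkQ _

theorem continuous_pullAb_iff {ω : C2 K (CurAb K A k)} :
    (Continuous fun p : (A ⊗[K] k) × (A ⊗[K] k) => (pullAb ω).val p.1 p.2) ↔
      Continuous fun p : CurAb K A k × CurAb K A k => ω.val p.1 p.2 :=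
  (((isOpenQuotientMap_toAb (K := K) (A := A) (k := k)).prodMap
    (isOpenQuotientMap_toAb (K := K) (A := A) (k := k))).isQuotientMap.continuous_iff
    (g := fun p : CurAb K A k × CurAb K A k => ω.val p.1 p.2)).symm

theorem B2c_curAb : B2c K (CurAb K A k) = ⊥ := by
  rw [eq_bot_iff]
  rintro _ ⟨ℓ, rfl⟩
  rw [Submodule.mem_bot]
  ext u v
  rw [LinearMap.comp_apply, d1_val, curAb_lie]
  simp

variable [ContinuousSMul K A] [PolynormableSpace K A]
  [FiniteDimensional K k] [IsTopologicalAddGroup k] [ContinuousSMul K k] [T2Space k]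

/-- If all values of `η` are coboundaries, a linear section of `d : C¹(k) → B²(k)` gives a
primitive of `(ax, by) ↦ η(ab)(x, y)`. -/
theorem mulCochain_mem_B2c {η : A →ₗ[K] C2 K k} (hη : Continuous η) (hB : ∀ a, η a ∈ B2 K k) :
    mulCochain η ∈ B2c K (A ⊗[K] k) := by
  obtain ⟨τ, hτ⟩ := (d1 K k).rangeRestrict.exists_rightInverse_of_surjective
    (LinearMap.range_rangeRestrict _)
  let η' : A →ₗ[K] LinearMap.range (d1 K k) := η.codRestrict _ hB
  have hη' : Continuous η' := hη.subtype_mk _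
  let ℓ : A ⊗[K] k →ₗ[K] K := TensorProduct.lift
    ((LinearMap.llcomp K k (Coeff K k) K (TrivialLieModule.equiv K k K).toLinearMap) ∘ₗ τ ∘ₗ η')
  have hℓ : ∀ a x, ℓ (a ⊗ₜ x) = TrivialLieModule.equiv K k K (τ (η' a) x) := fun _ _ => rfl
  have hc : Continuous ℓ := continuous_of_continuous_tmul_left fun x => by
    simp only [hℓ]
    exact ((show LinearMap.range (d1 K k) →ₗ[K] K from
      (TrivialLieModule.equiv K k K).toLinearMap ∘ₗ LinearMap.applyₗ x ∘ₗ
        τ).continuous_of_finiteDimensional).comp hη'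
  let ℓ' : A ⊗[K] k →L[K] Coeff K (A ⊗[K] k) :=
    ⟨(TrivialLieModule.equiv K (A ⊗[K] k) K).symm.toLinearMap ∘ₗ ℓ, hc⟩
  refine ⟨ℓ', C2.ext_tmul fun a b x y => ?_⟩
  have e : η (a * b) = d1 K k (τ (η' (a * b))) :=
    (congrArg Subtype.val (LinearMap.congr_fun hτ (η' (a * b)))).symm
  rw [mulCochain_tmul, e, d1_val, ← hℓ, LinearMap.comp_apply, d1_val,
    LieAlgebra.ExtendScalars.bracket_tmul]
  rfl

variable [IsTopologicalRing A]

theorem continuous_mulCochain {η : A →ₗ[K] C2 K k} (hη : Continuous η) :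
    Continuous fun p : (A ⊗[K] k) × (A ⊗[K] k) => (mulCochain η).val p.1 p.2 :=
  continuous_val_of_tmul fun x y =>
    (continuous_C2_val x y).comp (hη.comp (continuous_fst.mul continuous_snd))

end Topology

end Abelian

/-! ### The map `Φ` -/

section Phi

variable {K A k : Type*} [RCLike K] [CommRing A] [Algebra K A] [TopologicalSpace A]
  [LieRing k] [LieAlgebra K k] [FiniteDimensional K k]

variable (K k) in
/-- Continuous linear maps `A → H²(k)` lift to `Z²(k)`. -/
theorem exists_section_H2 : ∃ σ : H2 K k →L[K] Z2 K k,
    (Submodule.mkQL ((B2 K k).submoduleOf (Z2 K k))).comp σ = ContinuousLinearMap.id K _ := by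
  obtain ⟨σ, hσ⟩ := ((B2 K k).submoduleOf (Z2 K k)).mkQ.exists_rightInverse_of_surjective
    (Submodule.range_mkQ _)
  refine ⟨⟨σ, (Submodule.isQuotientMap_mkQ _).continuous_iff.2
    (LinearMap.continuous_of_finiteDimensional
      (σ ∘ₗ ((B2 K k).submoduleOf (Z2 K k)).mkQ))⟩, ?_⟩
  ext u
  exact LinearMap.congr_fun hσ u

variable [TopologicalSpace k]

theorem isPhi_unique {Φ Φ' : (H2c13 K A k × (A →L[K] H2 K k)) →ₗ[K] H2c K (Cur K A k)}
    (h : IsPhi Φ) (h' : IsPhi Φ') : Φ = Φ' := by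
  obtain ⟨σ, hσ⟩ := exists_section_H2 K k
  refine LinearMap.ext fun ⟨⟨c, hc⟩, g⟩ => ?_
  obtain ⟨ω, hω, rfl⟩ := hc
  obtain ⟨f, hf, e⟩ := h ⟨ω, hω⟩ (σ.comp g)
  obtain ⟨f', hf', e'⟩ := h' ⟨ω, hω⟩ (σ.comp g)
  rw [← ContinuousLinearMap.comp_assoc, hσ, ContinuousLinearMap.id_comp] at e e'
  have hff : f = f' := Subtype.ext <| C2.ext_tmul fun a b x y => by rw [hf, hf']
  exact e.trans ((congrArg _ hff).trans e'.symm)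

theorem IsPhi.injective {Φ : (H2c13 K A k × (A →L[K] H2 K k)) →ₗ[K] H2c K (Cur K A k)}
    (hΦ : IsPhi Φ) : Function.Injective Φ := by
  obtain ⟨σ, hσ⟩ := exists_section_H2 K k
  refine (injective_iff_map_eq_zero Φ).2 fun ⟨⟨c, hc⟩, g⟩ h0 => ?_
  obtain ⟨ω, hω, rfl⟩ := hc
  obtain ⟨f, hf, e⟩ := hΦ ⟨ω, hω⟩ (σ.comp g)
  rw [← ContinuousLinearMap.comp_assoc, hσ, ContinuousLinearMap.id_comp] at e
  obtain ⟨ℓ, hℓ⟩ : f.1 ∈ B2c K (Cur K A k) :=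
    (Submodule.Quotient.mk_eq_zero ((B2c K (Cur K A k)).submoduleOf (Z2c K (Cur K A k)))).1
      (e.symm.trans h0)
  have hfℓ : ∀ (a b : A) (x y : k), ω.1.val (cls a x) (cls b y) + (σ (g (a * b))).1.val x y =
      -TrivialLieModule.equiv K _ K (ℓ ((a * b) ⊗ₜ[K] ⁅x, y⁆)) := fun a b x y => by
    rw [← LieAlgebra.ExtendScalars.bracket_tmul]
    exact (hf a b x y).symm.trans ((congrArg (fun q : C2 K _ => q.val _ _) hℓ.symm).trans
      (d1_val _ _ _))
  have hω' : ∀ (a : A) (x y : k),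
    ω.1.val (cls a x) (cls 1 y) - ω.1.val (cls a y) (cls 1 x) = 0 := hω
  -- The condition on `ω` isolates `h(a)` in the part of the equation that is skew in `x` and `y`.
  have hh : ∀ (a : A) (x y : k), (σ (g a)).1.val x y =
      -TrivialLieModule.equiv K _ K (ℓ (a ⊗ₜ[K] ⁅x, y⁆)) := fun a x y => by
    have h1 := hfℓ a 1 x y
    have h2 := hfℓ a 1 y x
    rw [mul_one] at h1 h2
    rw [← lie_skew, TensorProduct.tmul_neg, map_neg, map_neg, (σ (g a)).1.val_skew y x] at h2
    linear_combination (h1 - h2 - hω' a x y) / 2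
  have hg : g = 0 := by
    ext a
    rw [← ContinuousLinearMap.id_comp g, ← hσ]
    refine (Submodule.Quotient.mk_eq_zero _).2 ?_
    let m : k →ₗ[K] Coeff K k := (TrivialLieModule.equiv K k K).symm.toLinearMap ∘ₗ
      (TrivialLieModule.equiv K (Cur K A k) K).toLinearMap ∘ₗ ℓ.toLinearMap ∘ₗ
        TensorProduct.mk K A k a
    exact ⟨m, C2.ext fun x y => (d1_val m x y).trans (hh a x y).symm⟩
  have hω0 : ω = 0 := Subtype.ext <| curAb_ext fun a b x y => by
    have h1 := hfℓ a b x y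
    rw [hh] at h1
    rw [Submodule.coe_zero, C2.val_zero]
    linear_combination h1
  subst hω0 hg
  rfl

variable [IsTopologicalRing A] [ContinuousSMul K A] [PolynormableSpace K A]
  [IsTopologicalAddGroup k] [ContinuousSMul K k] [T2Space k]

/-- The continuous cocycle `(ax, by) ↦ ω(ax, by) + h(ab)(x, y)`. -/
def phiCocycle (ω : Z2c K (CurAb K A k)) (h : A →L[K] Z2 K k) : Z2c K (Cur K A k) :=
  ⟨pullAb ω.1 + mulCochain ((Z2 K k).subtype ∘ₗ h.toLinearMap),
    add_mem (pullAb_mem_Z2 _) (mulCochain_mem_Z2 fun a => (h a).2),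
    (continuous_pullAb_iff.2 ω.2.2).add
      (continuous_mulCochain (continuous_subtype_val.comp h.continuous))⟩

theorem phiCocycle_tmul (ω : Z2c K (CurAb K A k)) (h : A →L[K] Z2 K k) (a b : A) (x y : k) :
    (phiCocycle ω h).1.val (a ⊗ₜ[K] x) (b ⊗ₜ[K] y) =
      ω.1.val (cls a x) (cls b y) + (h (a * b)).1.val x y := rfl

variable (K A k) in
/-- `phiCocycle` as a linear map. -/
def phiCocycleL : (Z2c K (CurAb K A k) × (A →L[K] Z2 K k)) →ₗ[K] Z2c K (Cur K A k) where
  toFun p := phiCocycle p.1 p.2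
  map_add' p q := Subtype.ext <| C2.ext_tmul fun a b x y => by
    rw [phiCocycle_tmul, Submodule.coe_add, C2.val_add, phiCocycle_tmul, phiCocycle_tmul]
    change _ + ((p.2 (a * b)).1.val x y + (q.2 (a * b)).1.val x y) = _
    rw [Prod.fst_add, Submodule.coe_add, C2.val_add]
    ring
  map_smul' c p := Subtype.ext <| C2.ext_tmul fun a b x y => by
    rw [phiCocycle_tmul, Submodule.coe_smul, C2.val_smul, RingHom.id_apply, phiCocycle_tmul]
    change _ + c * (p.2 (a * b)).1.val x y = _
    rw [Prod.smul_fst, Submodule.coe_smul, C2.val_smul]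
    ring

theorem exists_isPhi :
    ∃ Φ : (H2c13 K A k × (A →L[K] H2 K k)) →ₗ[K] H2c K (Cur K A k), IsPhi Φ := by
  obtain ⟨σ, hσ⟩ := exists_section_H2 K k
  -- The coboundaries of the abelian algebra `𝔤 / 𝔤'` are zero.
  have hB : (B2c K (CurAb K A k)).submoduleOf (Z2c K (CurAb K A k)) ≤ LinearMap.ker .id := by
    intro ω hω
    have h : ω.1 ∈ B2c K (CurAb K A k) := hω
    rw [B2c_curAb, Submodule.mem_bot] at h
    exact Subtype.ext h
  let s : H2c K (CurAb K A k) →ₗ[K] Z2c K (CurAb K A k) := Submodule.liftQ _ LinearMap.id hB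
  let t : (A →L[K] H2 K k) →ₗ[K] (A →L[K] Z2 K k) :=
    { toFun g := σ.comp g
      map_add' g g' := by ext; simp
      map_smul' c g := by ext; simp }
  refine ⟨Submodule.mkQ _ ∘ₗ phiCocycleL K A k ∘ₗ (s ∘ₗ (H2c13 K A k).subtype).prodMap t,
    fun ω h => ⟨phiCocycle ω.1 h, phiCocycle_tmul _ _, ?_⟩⟩
  change Submodule.Quotient.mk (phiCocycle ω.1 (σ.comp ((Submodule.mkQL _).comp h))) = _
  refine (Submodule.Quotient.eq _).2 ?_
  let η : A →L[K] C2 K k :=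
    (Z2 K k).subtypeL.comp (σ.comp ((Submodule.mkQL ((B2 K k).submoduleOf (Z2 K k))).comp h) - h)
  have hη : ∀ a, η a ∈ B2 K k := fun a =>
    (Submodule.Quotient.eq ((B2 K k).submoduleOf (Z2 K k))).1
      (DFunLike.congr_fun hσ (Submodule.Quotient.mk (h a)))
  change ((phiCocycle ω.1 _ - phiCocycle ω.1 h : Z2c K (Cur K A k)) : C2 K (Cur K A k)) ∈
    B2c K (Cur K A k)
  convert mulCochain_mem_B2c (η := η.toLinearMap) η.continuous hη using 1
  refine C2.ext_tmul fun a b x y => ?_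
  rw [Submodule.coe_sub, C2.val_sub, phiCocycle_tmul, phiCocycle_tmul, add_sub_add_left_eq_sub]
  rfl

end Phi

/-! ### The map `Ψ` -/

section Psi

variable {K A k : Type*} [RCLike K] [CommRing A] [Algebra K A]
  [LieRing k] [LieAlgebra K k]

/-- The bilinear map `(a, b) ↦ f₁(a, b)` of a cocycle `f`, with values in the invariant forms. -/
def symComp {f : C2 K (A ⊗[K] k)} (hf : f ∈ Z2 K (A ⊗[K] k)) : A →ₗ[K] A →ₗ[K] SymInv K k :=
  LinearMap.mk₂ K (fun a b => ⟨comp1 f a b, comp1_mem_symInv hf a b⟩)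
    (fun a a' b => Subtype.ext <| LinearMap.ext₂ fun x y => by
      simp only [Submodule.coe_add, LinearMap.add_apply, comp1_apply, TensorProduct.add_tmul,
        C2.val_add_left]
      ring)
    (fun c a b => Subtype.ext <| LinearMap.ext₂ fun x y => by
      simp only [Submodule.coe_smul, LinearMap.smul_apply, comp1_apply, smul_eq_mul,
        ← TensorProduct.smul_tmul', C2.val_smul_left]
      ring)
    (fun a b b' => Subtype.ext <| LinearMap.ext₂ fun x y => by
      simp only [Submodule.coe_add, LinearMap.add_apply, comp1_apply, TensorProduct.add_tmul,
        C2.val_add_right]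
      ring)
    (fun c a b => Subtype.ext <| LinearMap.ext₂ fun x y => by
      simp only [Submodule.coe_smul, LinearMap.smul_apply, comp1_apply, smul_eq_mul,
        ← TensorProduct.smul_tmul', C2.val_smul_right]
      ring)

/-- The Koszul map onto its range. -/
def koszulRange (K k : Type*) [RCLike K] [LieRing k] [LieAlgebra K k] :
    SymInv K k →ₗ[K] Z3Γ K k := (koszul K k).rangeRestrict

theorem mem_B3Γ_iff {u : Z3Γ K k} : u ∈ B3Γ K k ↔ ((u : Z3 K k) : Tri K k) ∈ B3 K k := Iff.rfl

variable [TopologicalSpace A]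

theorem linOmega_ext [FiniteDimensional K k] [IsTopologicalRing A] {ψ ψ' : LinOmega K A k}
    (h : ∀ a b : A, ψ.1 (a • dA K b - b • dA K a) = ψ'.1 (a • dA K b - b • dA K a)) : ψ = ψ' :=
  Subtype.ext <| ContinuousLinearMap.coe_injective <| OmegaC_hom_ext_skew h

variable [TopologicalSpace k]

theorem comp1_eq_zero_of_mem_B2c {f : C2 K (A ⊗[K] k)} (hf : f ∈ B2c K (A ⊗[K] k)) (a b : A) :
    comp1 f a b = 0 := by
  obtain ⟨ℓ, rfl⟩ := hf
  refine LinearMap.ext₂ fun x y => ?_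
  rw [comp1_apply, LinearMap.comp_apply, d1_val, d1_val,
    LieAlgebra.ExtendScalars.bracket_tmul, LieAlgebra.ExtendScalars.bracket_tmul,
    ← lie_skew y, TensorProduct.tmul_neg, map_neg, map_neg, LinearMap.zero_apply,
    LinearMap.zero_apply]
  ring

variable [FiniteDimensional K k] [IsTopologicalRing A]

theorem isPsi_unique {Ψ Ψ' : H2c K (Cur K A k) →ₗ[K] LinOmega K A k} (h : IsPsi Ψ)
    (h' : IsPsi Ψ') : Ψ = Ψ' := by
  refine LinearMap.ext fun u => ?_
  obtain ⟨f, rfl⟩ := Submodule.Quotient.mk_surjective _ u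
  exact linOmega_ext fun a b => Subtype.ext <| Subtype.ext <| (h f a b).trans (h' f a b).symm

/-- The map `Ψ([f])`. It takes values in `B³(k)` on `d(A)`, and then on the closure, because the
finite-dimensional subspace `B³(k)_Γ` is closed. -/
theorem exists_psi (f : Z2c K (Cur K A k)) : ∃ ψ : LinOmega K A k, ∀ a b : A,
    ((ψ.1 (a • dA K b - b • dA K a) : Z3 K k) : Tri K k) = koszulTri (comp1 f.1 a b) := by
  let D : A →ₗ[K] A →ₗ[K] Z3Γ K k := (symComp f.2.1).compr₂ (koszulRange K k)
  have hD : ∀ a b, ((D a b : Z3 K k) : Tri K k) = koszulTri (comp1 f.1 a b) := fun _ _ => rfl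
  have hs : ∀ a b, D a b = -D b a := fun a b => Subtype.ext <| Subtype.ext <| by
    refine Tri.ext fun x y z => (comp1_skew f.1 a b _ _).trans ?_
    change _ = (-koszulTri (comp1 f.1 b a)).val x y z
    rfl
  have hc : Continuous fun p : A × A => D p.1 p.2 := by
    refine continuous_induced_rng.2 (continuous_induced_rng.2 (continuous_Tri fun x y z => ?_))
    have h : ∀ x y : k, Continuous fun p : A × A => f.1.val (p.1 ⊗ₜ[K] x) (p.2 ⊗ₜ[K] y) :=
      fun x y => f.2.2.comp (((continuous_tmul_left x).comp continuous_fst).prodMk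
        ((continuous_tmul_left y).comp continuous_snd))
    exact ((h ⁅x, y⁆ z).add (h z ⁅x, y⁆)).div_const 2
  obtain ⟨φ, hφ⟩ := exists_OmegaC_hom_skew D hc hs fun a b c =>
    Subtype.ext <| Subtype.ext <| koszulTri_comp1_cyclic f.2.1 a b c
  have hmem : closure (Set.range (dA K (A := A))) ⊆ φ ⁻¹' (B3Γ K k : Set (Z3Γ K k)) := by
    refine closure_minimal ?_ (((B3Γ K k).closed_of_finiteDimensional).preimage φ.continuous)
    rintro _ ⟨a, rfl⟩
    have h := hφ 1 a
    rw [one_smul, dA_one, smul_zero, sub_zero, hs] at h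
    rw [Set.mem_preimage, h, SetLike.mem_coe, neg_mem_iff, mem_B3Γ_iff, hD,
      koszulTri_comp1_one f.2.1]
    exact LinearMap.mem_range_self _ _
  exact ⟨⟨φ, hmem⟩, fun a b => by rw [← hD, ← hφ]⟩

theorem exists_psi_linear : ∃ T : Z2c K (Cur K A k) →ₗ[K] LinOmega K A k, ∀ f (a b : A),
    (((T f).1 (a • dA K b - b • dA K a) : Z3 K k) : Tri K k) = koszulTri (comp1 f.1 a b) := by
  choose T hT using exists_psi (K := K) (A := A) (k := k)
  refine ⟨{ toFun := T, map_add' := fun f g => ?_, map_smul' := fun c f => ?_ }, hT⟩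
  · refine linOmega_ext fun a b => Subtype.ext <| Subtype.ext <|
      (hT _ a b).trans (Eq.trans ?_ (congrArg₂ (· + ·) (hT f a b) (hT g a b)).symm)
    ext x y z
    simp only [Tri.val_add, koszulTri_val, comp1_apply, Submodule.coe_add, C2.val_add]
    ring
  · refine linOmega_ext fun a b => Subtype.ext <| Subtype.ext <|
      (hT _ a b).trans (Eq.trans ?_ (congrArg (c • ·) (hT f a b)).symm)
    ext x y z
    simp only [Tri.val_smul, koszulTri_val, comp1_apply, Submodule.coe_smul, C2.val_smul]
    ring

/-- The universal property of a quotient for linear maps into a module whose addition is only known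
to be that of a commutative monoid. -/
theorem exists_linearMap_quotient {R M N : Type*} [Ring R] [AddCommGroup M] [Module R M]
    [AddCommMonoid N] [Module R N] (p : Submodule R M) (T : M →ₗ[R] N) (hT : ∀ x ∈ p, T x = 0) :
    ∃ S : M ⧸ p →ₗ[R] N, ∀ x, S (Submodule.Quotient.mk x) = T x := by
  have h : ∀ x y : M, (Submodule.Quotient.mk x : M ⧸ p) = Submodule.Quotient.mk y → T x = T y :=
    fun x y e => by
      rw [← sub_add_cancel x y, map_add, hT _ ((Submodule.Quotient.eq p).1 e), zero_add]
  have hout : ∀ u : M ⧸ p, Submodule.Quotient.mk u.out = u := fun u => Quotient.out_eq' u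
  refine ⟨{ toFun := fun u => T u.out, map_add' := fun u v => ?_, map_smul' := fun c u => ?_ },
    fun x => h _ _ (hout _)⟩
  · rw [← map_add]
    exact h _ _ (by rw [hout, Submodule.Quotient.mk_add, hout, hout])
  · rw [← map_smul]
    exact h _ _ (by rw [hout, Submodule.Quotient.mk_smul, hout]; rfl)

theorem exists_isPsi : ∃ Ψ : H2c K (Cur K A k) →ₗ[K] LinOmega K A k, IsPsi Ψ := by
  obtain ⟨T, hT⟩ := exists_psi_linear (K := K) (A := A) (k := k)
  obtain ⟨Ψ, hΨ⟩ := exists_linearMap_quotient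
    ((B2c K (Cur K A k)).submoduleOf (Z2c K (Cur K A k))) T fun f hf => by
      refine linOmega_ext fun a b => Subtype.ext <| Subtype.ext <| (hT f a b).trans ?_
      have e : comp1 f.1 a b = 0 := comp1_eq_zero_of_mem_B2c hf a b
      rw [e]
      rfl
  refine ⟨Ψ, fun f a b => ?_⟩
  rw [hΨ]
  exact hT f a b

end Psi

/-! ### Exactness -/

section Exact

variable {K A k : Type*} [RCLike K] [CommRing A] [Algebra K A] [TopologicalSpace A]
  [IsTopologicalRing A] [ContinuousSMul K A] [PolynormableSpace K A]
  [LieRing k] [LieAlgebra K k] [FiniteDimensional K k]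
  [TopologicalSpace k] [IsTopologicalAddGroup k] [ContinuousSMul K k] [T2Space k]

/-- A continuous cocycle whose forms `f₁(a, b)` are killed by the Koszul map is in the image
of `Φ`: the form `h(a) = f₂(a, 1)` is a cocycle, and `f(ax, by) - h(ab)(x, y)` vanishes on
`𝔤' × 𝔤`. -/
theorem exists_eq_phi {f : C2 K (Cur K A k)} (hf : f ∈ Z2c K (Cur K A k))
    (h0 : ∀ a b, koszulTri (comp1 f a b) = 0) :
    ∃ (ω : Z2c13 K A k) (h : A →L[K] Z2 K k), ∀ (a b : A) (x y : k),
      f.val (a ⊗ₜ[K] x) (b ⊗ₜ[K] y) =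
        ω.1.1.val (cls a x) (cls b y) + (h (a * b)).1.val x y := by
  have h0' : ∀ a b x y z, comp1 f a b ⁅x, y⁆ z = 0 := fun a b x y z =>
    congrArg (fun t : Tri K k => t.val x y z) (h0 a b)
  have hc : ∀ x y : k, Continuous fun a : A => f.val (a ⊗ₜ[K] x) (1 ⊗ₜ[K] y) :=
    fun x y => hf.2.comp ((continuous_tmul_left x).prodMk continuous_const)
  let h₀ : A →ₗ[K] Z2 K k :=
    { toFun a := ⟨comp2 f a 1, by
        rw [Z2, LinearMap.mem_ker, ← koszulTri_comp1_one hf.1, h0]⟩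
      map_add' a b := Subtype.ext <| C2.ext fun x y => by
        simp only [Submodule.coe_add, C2.val_add, comp2_val, TensorProduct.add_tmul,
          C2.val_add_left]
        ring
      map_smul' c a := Subtype.ext <| C2.ext fun x y => by
        simp only [Submodule.coe_smul, C2.val_smul, comp2_val, ← TensorProduct.smul_tmul',
          C2.val_smul_left, RingHom.id_apply]
        ring }
  let h : A →L[K] Z2 K k := ⟨h₀, continuous_induced_rng.2 <| continuous_C2 fun x y => by
    change Continuous fun a : A => (comp2 f a 1).val x y
    simp only [comp2_val]
    exact ((hc x y).sub (hc y x)).div_const 2⟩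
  let η : A →L[K] C2 K k := (Z2 K k).subtypeL.comp h
  obtain ⟨ω, hω⟩ := exists_pullAb_eq (g := f - mulCochain η.toLinearMap) fun a b c x y z => by
    rw [C2.val_sub, mulCochain_tmul, val_eq_comp, h0', comp2_lie hf.1, zero_add]
    exact sub_self _
  have hω' : ∀ a b x y, ω.val (cls a x) (cls b y) =
      f.val (a ⊗ₜ[K] x) (b ⊗ₜ[K] y) - (comp2 f (a * b) 1).val x y := fun a b x y =>
    congrArg (fun g : C2 K (Cur K A k) => g.val (a ⊗ₜ[K] x) (b ⊗ₜ[K] y)) hω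
  refine ⟨⟨⟨ω, mem_Z2_curAb ω, continuous_pullAb_iff.1 ?_⟩, fun a x y => ?_⟩, h,
    fun a b x y => ?_⟩
  · rw [hω]
    exact hf.2.sub (continuous_mulCochain η.continuous)
  · rw [hω', hω', mul_one, comp2_val, comp2_val]
    ring
  · rw [hω']
    exact (sub_add_cancel _ _).symm

theorem IsPhi.exact {Φ : (H2c13 K A k × (A →L[K] H2 K k)) →ₗ[K] H2c K (Cur K A k)}
    {Ψ : H2c K (Cur K A k) →ₗ[K] LinOmega K A k} (hΦ : IsPhi Φ) (hΨ : IsPsi Ψ) :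
    Function.Exact Φ Ψ := by
  intro u
  constructor
  · intro hu
    obtain ⟨f, rfl⟩ := Submodule.Quotient.mk_surjective _ u
    obtain ⟨ω, h, hf⟩ := exists_eq_phi f.2 fun a b => by
      rw [← hΨ f a b, hu]
      rfl
    obtain ⟨f', hf', e⟩ := hΦ ω h
    have hff : f' = f := Subtype.ext <| C2.ext_tmul fun a b x y => by rw [hf, hf']
    exact ⟨_, e.trans (congrArg _ hff)⟩
  · rintro ⟨⟨⟨c, hc⟩, g⟩, rfl⟩
    obtain ⟨ω, hω, rfl⟩ := hc
    obtain ⟨σ, hσ⟩ := exists_section_H2 K k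
    obtain ⟨f, hf, e⟩ := hΦ ⟨ω, hω⟩ (σ.comp g)
    rw [← ContinuousLinearMap.comp_assoc, hσ, ContinuousLinearMap.id_comp] at e
    refine (congrArg Ψ e).trans <| linOmega_ext fun a b => Subtype.ext <| Subtype.ext <|
      (hΨ f a b).trans ?_
    ext x y z
    rw [koszulTri_val, comp1_apply, hf, hf, cls_lie, cls_lie, C2.val_zero_left, C2.val_zero_right,
      C2.val_skew _ z]
    change _ = (0 : K)
    ring

/-- The form `(ax, by) ↦ S(a, b)(x, y) + η(ab)(x, y)`, with `S` alternating, is a continuous cocycle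
with `f₁ = S` if the cyclic sum of `Γ(S(ab, c))` is `dη(abc)`. -/
theorem exists_cocycle_of_comp {S : A →ₗ[K] A →ₗ[K] SymInv K k} {η : A →ₗ[K] C2 K k}
    (hS : ∀ a b x y, (S a b).1 x y = -(S b a).1 x y)
    (hSc : ∀ x y, Continuous fun p : A × A => (S p.1 p.2).1 x y) (hη : Continuous η)
    (h : ∀ a b c, koszulTri (S (a * b) c).1 + koszulTri (S (b * c) a).1 + koszulTri (S (c * a) b).1
      = d2 K k (η (a * b * c))) :
    ∃ f : Z2c K (Cur K A k), ∀ a b, comp1 f.1 a b = (S a b).1 := by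
  let f₁ : C2 K (Cur K A k) := curCochain (S.compr₂ (SymInv K k).subtype) fun a b x y => by
    change (S a b).1 x y = -(S b a).1 y x
    rw [hS, (S b a).2.1 y x]
  have hf : ∀ a b x y, (f₁ + mulCochain η).val (a ⊗ₜ[K] x) (b ⊗ₜ[K] y) =
    (S a b).1 x y + (η (a * b)).val x y := fun _ _ _ _ => rfl
  have hf₁ : Continuous fun p : Cur K A k × Cur K A k => f₁.val p.1 p.2 :=
    continuous_val_of_tmul hSc
  refine ⟨⟨f₁ + mulCochain η, mem_Z2_of_comp hf h, hf₁.add (continuous_mulCochain hη)⟩,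
    fun a b => LinearMap.ext₂ fun x y => ?_⟩
  rw [comp1_apply, hf, hf, (S a b).2.1 y x, (η (a * b)).val_skew y x]
  ring

/-- Linear sections of the Koszul map and of `d : C²(k) → B³(k)` turn an alternating bilinear map
`D` with values in the image of the Koszul map into the two components of a cocycle. -/
theorem exists_cocycle_of_skew (D : A →ₗ[K] A →ₗ[K] Z3Γ K k) (δ : A →ₗ[K] Z3Γ K k)
    (hDc : Continuous fun p : A × A => D p.1 p.2) (hδc : Continuous δ)
    (hD : ∀ a b, D a b = -D b a)
    (hm : ∀ a b c, D (a * b) c + D (b * c) a + D (c * a) b = δ (a * b * c))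
    (hδ : ∀ a, δ a ∈ B3Γ K k) :
    ∃ f : Z2c K (Cur K A k), ∀ a b,
      koszulTri (comp1 f.1 a b) = ((D a b : Z3 K k) : Tri K k) := by
  obtain ⟨σ, hσ⟩ := (koszulRange K k).exists_rightInverse_of_surjective
    (LinearMap.range_rangeRestrict _)
  obtain ⟨τ, hτ⟩ := (d2 K k).rangeRestrict.exists_rightInverse_of_surjective
    (LinearMap.range_rangeRestrict _)
  let S : A →ₗ[K] A →ₗ[K] SymInv K k := D.compr₂ σ
  have hS : ∀ a b, koszulTri (S a b).1 = ((D a b : Z3 K k) : Tri K k) := fun a b =>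
    congrArg (fun u : Z3Γ K k => ((u : Z3 K k) : Tri K k)) (LinearMap.congr_fun hσ (D a b))
  have hSs : ∀ a b x y, (S a b).1 x y = -(S b a).1 x y := fun a b x y => by
    have h : S b a = (-1 : K) • S a b := by
      change σ (D b a) = (-1 : K) • σ (D a b)
      rw [← map_smul]
      exact congrArg σ ((hD b a).trans (neg_one_smul K (D a b)).symm)
    rw [h]
    change _ = -((-1 : K) * (S a b).1 x y)
    ring
  have hSc : ∀ x y, Continuous fun p : A × A => (S p.1 p.2).1 x y := fun x y =>
    (LinearMap.continuous_of_finiteDimensional (show Z3Γ K k →ₗ[K] K from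
      LinearMap.applyₗ y ∘ₗ LinearMap.applyₗ x ∘ₗ (SymInv K k).subtype ∘ₗ σ)).comp hDc
  let θ : A →ₗ[K] LinearMap.range (d2 K k) :=
    ((Z3 K k).subtype ∘ₗ (Z3Γ K k).subtype ∘ₗ δ).codRestrict _ hδ
  have hθc : Continuous θ :=
    (continuous_subtype_val.comp (continuous_subtype_val.comp hδc)).subtype_mk _
  have hη : ∀ a, d2 K k (τ (θ a)) = ((δ a : Z3 K k) : Tri K k) := fun a =>
    congrArg Subtype.val (LinearMap.congr_fun hτ (θ a))
  obtain ⟨f, hf⟩ := exists_cocycle_of_comp (η := τ ∘ₗ θ) hSs hSc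
    (τ.continuous_of_finiteDimensional.comp hθc) fun a b c => by
      rw [hS, hS, hS, LinearMap.comp_apply, hη, ← hm]
      rfl
  exact ⟨f, fun a b => by rw [hf, hS]⟩

theorem IsPsi.surjective {Ψ : H2c K (Cur K A k) →ₗ[K] LinOmega K A k} (hΨ : IsPsi Ψ) :
    Function.Surjective Ψ := by
  intro ψ
  have hδ : ∀ a, (-(ψ.1.toLinearMap ∘ₗ dAL K A)) a ∈ B3Γ K k := fun a =>
    neg_mem (ψ.2 _ (subset_closure ⟨a, rfl⟩) : ψ.1 (dA K a) ∈ B3Γ K k)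
  obtain ⟨f, hf⟩ := exists_cocycle_of_skew (skewForm ψ.1.toLinearMap)
    (-(ψ.1.toLinearMap ∘ₗ dAL K A)) (continuous_skewForm ψ.1)
    (ψ.1.continuous.comp continuous_dA).neg
    (skewForm_skew _) (skewForm_cyclic _) hδ
  exact ⟨Submodule.Quotient.mk f, linOmega_ext fun a b => Subtype.ext <| Subtype.ext <|
    (hΨ f a b).trans (hf a b)⟩

end Exact

end CurrentAlg

end

theorem mainTheorem8 {K A k : Type*} [RCLike K]
    [CommRing A] [Algebra K A] [TopologicalSpace A] [IsTopologicalRing A] [ContinuousSMul K A]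
    [PolynormableSpace K A]
    [LieRing k] [LieAlgebra K k] [FiniteDimensional K k]
    [TopologicalSpace k] [IsTopologicalAddGroup k] [ContinuousSMul K k] [T2Space k] :
    (∃! Φ : (CurrentAlg.H2c13 K A k × (A →L[K] CurrentAlg.H2 K k)) →ₗ[K]
        CurrentAlg.H2c K (CurrentAlg.Cur K A k), CurrentAlg.IsPhi Φ) ∧
    (∃! Ψ : CurrentAlg.H2c K (CurrentAlg.Cur K A k) →ₗ[K] CurrentAlg.LinOmega K A k,
        CurrentAlg.IsPsi Ψ) ∧
    ∀ (Φ : (CurrentAlg.H2c13 K A k × (A →L[K] CurrentAlg.H2 K k)) →ₗ[K]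
        CurrentAlg.H2c K (CurrentAlg.Cur K A k))
      (Ψ : CurrentAlg.H2c K (CurrentAlg.Cur K A k) →ₗ[K] CurrentAlg.LinOmega K A k),
      CurrentAlg.IsPhi Φ → CurrentAlg.IsPsi Ψ →
        Function.Injective Φ ∧ Function.Exact Φ Ψ ∧ Function.Surjective Ψ := by
  obtain ⟨Φ, hΦ⟩ := CurrentAlg.exists_isPhi (K := K) (A := A) (k := k)
  obtain ⟨Ψ, hΨ⟩ := CurrentAlg.exists_isPsi (K := K) (A := A) (k := k)
  exact ⟨⟨Φ, hΦ, fun _ h => CurrentAlg.isPhi_unique h hΦ⟩,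
    ⟨Ψ, hΨ, fun _ h => CurrentAlg.isPsi_unique h hΨ⟩,
    fun _ _ h h' => ⟨h.injective, h.exact h', h'.surjective⟩⟩
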